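/- Let $n\ge 3$. An $n$-edge arm in $\mathbb R^3$ (up to translation) is a list of edge vectors $\vec e=(\vec e_1,\dots,\vec e_n)\in(\mathbb R^3)^n=:\mathscr A_3(n)$, and $\mathscr P_3(n)=\{\vec e:\sum_i\vec e_i=0\}$ is the linear subspace of closed polygons. Let $\operatorname{Hopf}:\mathbb H\to\operatorname{Im}\mathbb H\cong\mathbb R^3$, $\operatorname{Hopf}(q)=\bar q\,\mathbf i\,q$. The Hopf-Gaussian measure $\operatorname H$ on $\mathscr A_3(n)$ is the pushforward of the standard Gaussian measure on $\mathbb H^n=\mathbb R^{4n}$ under the coordinatewise Hopf map, and the Hopf-Gaussian measure on $\mathscr P_3(n)$ is the subspace probability measure inherited from it, i.e. $\operatorname H$ conditioned on closure: the Lebesgue density of $\operatorname H$ on $\mathbb R^{3n}$, restricted to the subspace $\mathscr P_3(n)$, taken against the $(3n-3)$-dimensional Hausdorff measure and normalized. This is a well-defined probability measure carried by $\mathscr P_3(n)$, and the following hold for it (all the expectations being finite). 1. For every real $p>-2$ and every $i$, $$E\big(|\vec e_i|^p;\mathscr P_3(n),\operatorname H\big)=\frac{(n-1)\,\Gamma(2n+p-3)}{2\,\Gamma(2n-4)}\,\mathrm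 B(p+2,n-2),$$ where $\mathrm B$ is the Euler beta function. 2. Let $v_0=0$ and $v_m=\vec e_1+\dots+\vec e_m$, with the edges indexed cyclically modulo $n$. For every $0\le k\le n$ and every starting vertex $v_i$, the squared length of the chord skipping $k$ edges satisfies $$E\big(|v_{i+k}-v_i|^2;\mathscr P_3(n),\operatorname H\big)=\left(\frac{n-k}{n}\right)\frac{12k(2n-3)}{n+1}.$$ 3. The squared radius of gyration $\frac1{2n^2}\sum_{i,j=0}^{n-1}|v_i-v_j|^2$ satisfies $$E\Big(\frac1{2n^2}\sum_{i,j=0}^{n-1}|v_i-v_j|^2;\mathscr P_3(n),\operatorname H\Big)=\left(\frac{n-1}{n}\right)(2n-3).$$ -/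

import Mathlib

open MeasureTheory ProbabilityTheory Filter Topology
open scoped ENNReal Quaternion

noncomputable section

/-! ### Polygonal arms in space -/

/-- The space `𝒜₃(n)` of `n`-edge polygonal arms in `ℝ³` up to translation: lists of edge vectors
`(e₁, …, eₙ) ∈ ℝ³ × ⋯ × ℝ³ = ℝ³ⁿ`, with the Euclidean metric of `ℝ³ⁿ`. -/
abbrev Arm (n : ℕ) : Type := PiLp 2 (fun _ : Fin n => EuclideanSpace ℝ (Fin 3))

/-- The subspace `𝒫₃(n)` of closed polygons: those arms whose edges sum to zero. -/
def closedPolygons (n : ℕ) : Submodule ℝ (Arm n) where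
  carrier := {e | ∑ i, e i = 0}
  add_mem' := by
    intro a b ha hb
    simp only [Set.mem_ofPred_eq, PiLp.add_apply, Finset.sum_add_distrib] at *
    rw [ha, hb, add_zero]
  zero_mem' := by simp
  smul_mem' := by
    intro c a ha
    simp only [Set.mem_ofPred_eq, PiLp.smul_apply, ← Finset.smul_sum] at *
    rw [ha, smul_zero]

/-- The vertices of a polygon whose zeroth vertex is at the origin:
`vertex e m = e₀ + ⋯ + e_{m-1}`, where the edges are indexed cyclically (modulo `n`). -/
def vertex {n : ℕ} [NeZero n] (e : Arm n) (m : ℕ) : EuclideanSpace ℝ (Fin 3) :=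
  ∑ j ∈ Finset.range m, e (Fin.ofNat n j)

/-- The squared length of the chord which starts at the vertex `i` and skips `k` edges. -/
def chordSq {n : ℕ} [NeZero n] (k : ℕ) (i : Fin n) (e : Arm n) : ℝ :=
  ‖vertex e (i + k) - vertex e i‖ ^ 2

/-- The squared radius of gyration of a closed polygon: half of the average squared distance over
all ordered pairs of its `n` vertices (equivalently, the average squared distance of the vertices
from their centre of mass). -/
def gyradiusSq {n : ℕ} [NeZero n] (e : Arm n) : ℝ :=
  (1 / (2 * (n : ℝ) ^ 2)) * ∑ i : Fin n, ∑ j : Fin n, ‖vertex e i - vertex e j‖ ^ 2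

/-! ### The Hopf-Gaussian measure on arms -/

/-- The quaternion unit `𝐢`. -/
def quaternionI : ℍ[ℝ] := ⟨0, 1, 0, 0⟩

/-- The Hopf map `q ↦ q̄ 𝐢 q` from the quaternions to the imaginary quaternions `≅ ℝ³`. -/
def hopf (q : ℍ[ℝ]) : EuclideanSpace ℝ (Fin 3) :=
  let h : ℍ[ℝ] := star q * quaternionI * q
  !₂[h.imI, h.imJ, h.imK]

theorem hopf_apply (q : ℍ[ℝ]) :
    hopf q = !₂[q.re ^ 2 + q.imI ^ 2 - q.imJ ^ 2 - q.imK ^ 2,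
      2 * q.imI * q.imJ - 2 * q.re * q.imK, 2 * q.re * q.imJ + 2 * q.imI * q.imK] := by
  have h0 : quaternionI.re = 0 := rfl
  have h1 : quaternionI.imI = 1 := rfl
  have h2 : quaternionI.imJ = 0 := rfl
  have h3 : quaternionI.imK = 0 := rfl
  ext i
  fin_cases i <;> simp [hopf, h0, h1, h2, h3] <;> ring

/-- The coordinatewise Hopf map `ℍⁿ → ℝ³ⁿ`, with `ℍⁿ` written in real coordinates. -/
def hopfArm (n : ℕ) (x : Fin n → Fin 4 → ℝ) : Arm n :=
  WithLp.toLp 2 fun i => hopf ((Quaternion.equivTuple ℝ).symm (x i))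

/-- The standard Gaussian measure `γ⁴ⁿ` on `ℍⁿ = ℝ⁴ⁿ`. -/
def quaternionGaussian (n : ℕ) : Measure (Fin n → Fin 4 → ℝ) :=
  Measure.pi fun _ => Measure.pi fun _ => gaussianReal 0 1

/-- The Hopf-Gaussian measure on `𝒜₃(n)`: the pushforward of the standard Gaussian measure on
`ℍⁿ` under the coordinatewise Hopf map. -/
def hopfGaussianArm (n : ℕ) : Measure (Arm n) :=
  (quaternionGaussian n).map (hopfArm n)

/-! ### The subspace measure and the Hopf-Gaussian measure on closed polygons -/

section SubspaceMeasure

variable {E : Type*} [NormedAddCommGroup E] [InnerProductSpace ℝ E] [FiniteDimensional ℝ E]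
  [MeasurableSpace E] [BorelSpace E]

/-- The pointwise density of `μ` with respect to Lebesgue measure,
`x ↦ lim_{ε → 0} μ(B(x, ε)) / vol(B(x, ε))`. The upper limit gives a value at every point; where
`μ` has a continuous density, that density is the limit. -/
def pointDensity (μ : Measure E) (x : E) : ℝ≥0∞ :=
  limsup (fun ε : ℝ => μ (Metric.ball x ε) / volume (Metric.ball x ε)) (𝓝[>] 0)

/-- The subspace probability measure which an absolutely continuous measure `μ` on a Euclidean
space `E` induces on a linear subspace `S` (the law of a random point of `E` conditioned to lie on
`S`): the density of `μ`, taken against the Hausdorff measure of `S` in the dimension of `S`, and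
normalized. It is a measure on `E` which is carried by `S`. -/
def subspaceMeasure (μ : Measure E) (S : Submodule ℝ E) : Measure E :=
  let m : Measure E :=
    ((Measure.hausdorffMeasure (Module.finrank ℝ S : ℝ)).restrict (S : Set E)).withDensity
      (pointDensity μ)
  (m Set.univ)⁻¹ • m

end SubspaceMeasure

/-- The Hopf-Gaussian measure on the space `𝒫₃(n)` of closed polygons: the subspace measure
inherited from the Hopf-Gaussian measure on `𝒜₃(n)`. -/
def hopfGaussianClosed (n : ℕ) : Measure (Arm n) :=
  subspaceMeasure (hopfGaussianArm n) (closedPolygons n)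

end

/-! The Hopf image of a standard Gaussian quaternion has characteristic function 1/(1+4|ξ|²)
(`charFun_hopfLaw`), so a sum of k+1 independent images has its (k+1)-st power. The law of the sum
is recognised rather than computed by convolution. The radial measure `hopfProfileMeasure k`
projects onto a line as a multiple of the law of the difference of two independent gamma variables
with density u^k exp(-u/2). That difference has characteristic function proportional to
(1+4t²)^{-(k+1)}, and a rotation-invariant measure is determined by its projection to a line
(`exists_charFun_hopfProfileMeasure`). The case k = 0 gives the density of one edge, proportional to
exp(-|x|/2)/|x|.

On closed polygons, n-1 edges are free and the last is minus their sum. Up to a constant, the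
marginal density of that edge is therefore the density of one edge times the density of a sum of n-1
edges (`exists_lintegral_edge_hopfGaussianClosedAux`). In polar coordinates the p-th moment is then
a double integral that separates into a gamma and a beta integral
(`lintegral_rpow_mul_hopfProfile`). Constants are known only to be positive and finite; dividing by
the case p = 0 removes them.

The conditioned law is invariant under permuting edges, and the edges sum to zero, so E⟨e_a, e_b⟩ =
-E|e_a|²/(n-1) for a ≠ b. A chord is a sum of k distinct edges, so its second moment follows from
the case p = 2; the radius of gyration is an average of chords. -/

/-! ### Radial integration and projection to a line -/

theorem lintegral_fun_norm_addHaar {E : Type*} [NormedAddCommGroup E] [NormedSpace ℝ E]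
    [MeasurableSpace E] [BorelSpace E] [FiniteDimensional ℝ E] [Nontrivial E] (μ : Measure E)
    [μ.IsAddHaarMeasure] {g : ℝ → ℝ≥0∞} (hg : Measurable g) :
    ∫⁻ x, g ‖x‖ ∂μ = (Module.finrank ℝ E * μ (Metric.ball 0 1)) *
      ∫⁻ r in Set.Ioi (0 : ℝ), ENNReal.ofReal (r ^ (Module.finrank ℝ E - 1)) * g r := by
  have h1 : ∫⁻ x, g ‖x‖ ∂μ = ∫⁻ x : ({(0)}ᶜ : Set E), g ‖x.1‖ ∂(μ.comap (↑)) := by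
    rw [lintegral_subtype_comap (measurableSet_singleton _).compl fun x ↦ g ‖x‖,
      restrict_compl_singleton]
  have h2 : ∫⁻ x : ({(0)}ᶜ : Set E), g ‖x.1‖ ∂(μ.comap (↑)) =
      ∫⁻ x, g x.2 ∂μ.toSphere.prod (.volumeIoiPow (Module.finrank ℝ E - 1)) := by
    rw [← μ.measurePreserving_homeomorphUnitSphereProd.lintegral_comp_emb
      (Homeomorph.measurableEmbedding _)]
    simp only [homeomorphUnitSphereProd_apply_snd_coe]
  rw [h1, h2, lintegral_prod _ (by fun_prop)]
  simp only [lintegral_const, Measure.toSphere_apply_univ]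
  rw [mul_comm]
  congr 1
  rw [Measure.volumeIoiPow, lintegral_withDensity_eq_lintegral_mul _ (by fun_prop) (by fun_prop)]
  simp only [Pi.mul_apply]
  rw [lintegral_subtype_comap measurableSet_Ioi
    fun a ↦ ENNReal.ofReal (a ^ (Module.finrank ℝ E - 1)) * g a]

theorem image_sq_Ioi {a : ℝ} (ha : 0 ≤ a) :
    (fun t : ℝ => t ^ 2) '' Set.Ioi a = Set.Ioi (a ^ 2) := by
  ext w
  simp only [Set.mem_image, Set.mem_Ioi]
  constructor
  · rintro ⟨t, ht, rfl⟩
    exact pow_lt_pow_left₀ ht ha two_ne_zero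
  · intro hw
    exact ⟨√w, (Real.lt_sqrt ha).2 hw, Real.sq_sqrt ((sq_nonneg a).trans hw.le)⟩

theorem lintegral_Ioi_sq {a : ℝ} (ha : 0 ≤ a) (g : ℝ → ℝ≥0∞) :
    ∫⁻ w in Set.Ioi (a ^ 2), g w = ∫⁻ t in Set.Ioi a, ENNReal.ofReal (2 * t) * g (t ^ 2) := by
  rw [← image_sq_Ioi ha]
  exact lintegral_image_eq_lintegral_deriv_mul_of_monotoneOn measurableSet_Ioi
    (fun t _ => by simpa using (hasDerivAt_pow 2 t).hasDerivWithinAt)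
    (fun x hx y _ hxy => pow_le_pow_left₀ (ha.trans (le_of_lt hx)) hxy 2) g

theorem lintegral_Ioi_add (a b : ℝ) (g : ℝ → ℝ≥0∞) :
    ∫⁻ w in Set.Ioi b, g (a + w) = ∫⁻ w in Set.Ioi (a + b), g w := by
  rw [← lintegral_indicator measurableSet_Ioi, ← lintegral_indicator measurableSet_Ioi,
    ← lintegral_add_left_eq_self ((Set.Ioi (a + b)).indicator g) a]
  congr 1
  ext w
  simp [Set.indicator]

/-- Integration of a function of one coordinate and of the norm in three-dimensional space. -/
theorem exists_lintegral_coord_normSq : ∃ C : ℝ≥0∞, C ≠ 0 ∧ C ≠ ∞ ∧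
    ∀ g : ℝ → ℝ → ℝ≥0∞, Measurable (Function.uncurry g) →
      ∫⁻ x : EuclideanSpace ℝ (Fin 3), g (x 0) (‖x‖ ^ 2) =
        C * ∫⁻ s, ∫⁻ w in Set.Ioi (s ^ 2), g s w := by
  obtain ⟨c, hc⟩ : ∃ c : ℝ≥0∞, c = Module.finrank ℝ (EuclideanSpace ℝ (Fin 2)) *
    volume (Metric.ball (0 : EuclideanSpace ℝ (Fin 2)) 1) := ⟨_, rfl⟩
  have hc0 : c ≠ 0 := by
    rw [hc]
    refine mul_ne_zero (by simp) (Metric.measure_ball_pos _ _ one_pos).ne'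
  have hct : c ≠ ∞ := hc ▸ ENNReal.mul_ne_top (by simp) measure_ball_lt_top.ne
  refine ⟨c * (2⁻¹ : ℝ≥0∞), by simp [hc0], ENNReal.mul_ne_top hct (by simp), fun g hg => ?_⟩
  have h1 : ∫⁻ x : EuclideanSpace ℝ (Fin 3), g (x 0) (‖x‖ ^ 2) =
      ∫⁻ x : Fin 3 → ℝ, g (x 0) (x 0 ^ 2 + (x 1 ^ 2 + x 2 ^ 2)) := by
    rw [← (PiLp.volume_preserving_toLp (Fin 3)).lintegral_comp_emb
      (MeasurableEquiv.toLp 2 (Fin 3 → ℝ)).measurableEmbedding]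
    simp [EuclideanSpace.norm_sq_eq, Fin.sum_univ_three, add_assoc]
  have h2 : ∫⁻ x : Fin 3 → ℝ, g (x 0) (x 0 ^ 2 + (x 1 ^ 2 + x 2 ^ 2)) =
      ∫⁻ p : ℝ × (Fin 2 → ℝ), g p.1 (p.1 ^ 2 + (p.2 0 ^ 2 + p.2 1 ^ 2)) := by
    rw [← (volume_preserving_piFinSuccAbove (fun _ : Fin 3 => ℝ) 0).lintegral_comp_emb
      (MeasurableEquiv.measurableEmbedding _)]
    rfl
  -- Polar coordinates in the plane orthogonal to the first axis: with w = s² + r² one has r dr =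
  -- dw/2, which is the factor 2⁻¹.
  have h3 : ∀ s : ℝ, ∫⁻ y : Fin 2 → ℝ, g s (s ^ 2 + (y 0 ^ 2 + y 1 ^ 2)) =
      c * 2⁻¹ * ∫⁻ w in Set.Ioi (s ^ 2), g s w := by
    intro s
    have h4 : ∫⁻ y : Fin 2 → ℝ, g s (s ^ 2 + (y 0 ^ 2 + y 1 ^ 2)) =
        ∫⁻ y : EuclideanSpace ℝ (Fin 2), g s (s ^ 2 + ‖y‖ ^ 2) := by
      rw [← (PiLp.volume_preserving_toLp (Fin 2)).lintegral_comp_emb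
        (MeasurableEquiv.toLp 2 (Fin 2 → ℝ)).measurableEmbedding]
      simp [EuclideanSpace.norm_sq_eq, Fin.sum_univ_two]
    have h5 : ∫⁻ w in Set.Ioi (s ^ 2), g s w =
        ∫⁻ r in Set.Ioi (0 : ℝ), ENNReal.ofReal (2 * r) * g s (s ^ 2 + r ^ 2) := by
      rw [← lintegral_Ioi_sq le_rfl fun w => g s (s ^ 2 + w), lintegral_Ioi_add]
      simp
    rw [h4, lintegral_fun_norm_addHaar volume (g := fun r => g s (s ^ 2 + r ^ 2)) (by fun_prop),
      ← hc, h5, mul_assoc c 2⁻¹, ← lintegral_const_mul 2⁻¹ (by fun_prop)]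
    congr 1
    refine lintegral_congr fun r => ?_
    have : ENNReal.ofReal (2 * r) = 2 * ENNReal.ofReal r := by
      rw [ENNReal.ofReal_mul zero_le_two]; simp
    rw [this, ← mul_assoc, ← mul_assoc, ENNReal.inv_mul_cancel (by simp) (by simp)]
    simp
  rw [h1, h2, Measure.volume_eq_prod, lintegral_prod _ (by fun_prop)]
  simp only [h3]
  rw [lintegral_const_mul']
  exact ENNReal.mul_ne_top hct (by simp)

/-! ### Gamma variables and their differences -/

theorem integrableOn_pow_mul_cexp (k : ℕ) {z : ℂ} (hz : 0 < z.re) :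
    IntegrableOn (fun v : ℝ => (v : ℂ) ^ k * Complex.exp (-z * v)) (Set.Ioi 0) := by
  have h := integrableOn_rpow_mul_exp_neg_mul_rpow (s := k) (p := 1) (b := z.re)
    (by linarith [(Nat.cast_nonneg k : (0 : ℝ) ≤ k)]) zero_lt_one hz
  refine h.mono' (by fun_prop) ((ae_restrict_mem measurableSet_Ioi).mono fun v hv => ?_)
  have hv' : 0 < v := hv
  simp [Complex.norm_exp, abs_of_pos hv']

theorem integral_pow_mul_cexp (k : ℕ) {z : ℂ} (hz : 0 < z.re) :
    ∫ v : ℝ in Set.Ioi 0, (v : ℂ) ^ k * Complex.exp (-z * v) = k.factorial / z ^ (k + 1) := by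
  have hz0 : z ≠ 0 := by rintro rfl; simp at hz
  have hlim : ∀ k : ℕ, Tendsto (fun v : ℝ => (v : ℂ) ^ k * Complex.exp (-z * v)) atTop (𝓝 0) := by
    intro k
    rw [tendsto_zero_iff_norm_tendsto_zero]
    refine (tendsto_rpow_mul_exp_neg_mul_atTop_nhds_zero k z.re hz).congr' ?_
    filter_upwards [eventually_gt_atTop 0] with v hv
    simp [Complex.norm_exp, abs_of_pos hv]
  have hd : ∀ v : ℝ, HasDerivAt (fun v : ℝ => Complex.exp (-z * v))
      (-z * Complex.exp (-z * v)) v := by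
    intro v
    have := ((Complex.ofRealCLM.hasDerivAt (x := v)).const_mul (-z)).cexp
    simpa [mul_comm] using this
  induction k with
  | zero =>
    have := integral_Ioi_of_hasDerivAt_of_tendsto' (a := 0)
      (f := fun v : ℝ => (-1 / z) * Complex.exp (-z * v))
      (f' := fun v : ℝ => (v : ℂ) ^ 0 * Complex.exp (-z * v)) (m := 0)
      (fun v _ => by
        refine ((hd v).const_mul (-1 / z)).congr_deriv ?_
        field_simp) (integrableOn_pow_mul_cexp 0 hz)
      (by simpa using (hlim 0).const_mul (-1 / z))
    rw [this]
    simp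
    ring
  | succ k ih =>
    have h1 := integrableOn_pow_mul_cexp k hz
    have h2 := integrableOn_pow_mul_cexp (k + 1) hz
    -- Integration by parts: the derivative of v^(k+1) exp(-zv) has integral zero, so z times the
    -- (k+1)-st integral is k+1 times the k-th.
    have := integral_Ioi_of_hasDerivAt_of_tendsto' (a := 0)
      (f := fun v : ℝ => (v : ℂ) ^ (k + 1) * Complex.exp (-z * v))
      (f' := fun v : ℝ => (k + 1) * ((v : ℂ) ^ k * Complex.exp (-z * v)) -
        z * ((v : ℂ) ^ (k + 1) * Complex.exp (-z * v))) (m := 0)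
      (fun v _ => by
        refine (((Complex.ofRealCLM.hasDerivAt (x := v)).pow (k + 1)).mul (hd v)).congr_deriv ?_
        simp
        ring) ((h1.const_mul _).sub (h2.const_mul _)) (hlim _)
    rw [integral_sub (h1.const_mul _) (h2.const_mul _), integral_const_mul, integral_const_mul,
      ih] at this
    simp only [Complex.ofReal_zero, ne_eq, Nat.add_eq_zero_iff, one_ne_zero, and_false,
      not_false_eq_true, zero_pow, zero_mul, sub_zero] at this
    have this := (sub_eq_zero.1 this).symm
    rw [eq_div_iff (pow_ne_zero _ hz0), pow_succ z, mul_comm, mul_assoc, this]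
    push_cast [Nat.factorial_succ]
    field_simp

/-- The unnormalised density `u ^ k * exp (-u / 2)` of a gamma distribution. -/
noncomputable def gammaWeight (k : ℕ) : ℝ → ℝ≥0∞ :=
  (Set.Ioi 0).indicator fun u => ENNReal.ofReal (u ^ k * Real.exp (-u / 2))

@[fun_prop]
theorem measurable_gammaWeight (k : ℕ) : Measurable (gammaWeight k) :=
  Measurable.indicator (by fun_prop) measurableSet_Ioi

/-- The unnormalised gamma distribution with density `u ^ k * exp (-u / 2)`. -/
noncomputable def gammaWeightMeasure (k : ℕ) : Measure ℝ :=
  volume.withDensity (gammaWeight k)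

theorem lintegral_gammaWeight_lt_top (k : ℕ) : ∫⁻ u, gammaWeight k u < ∞ := by
  have h := (integrableOn_pow_mul_cexp k (z := 1 / 2) (by norm_num)).2
  rw [HasFiniteIntegral] at h
  rw [gammaWeight, lintegral_indicator measurableSet_Ioi]
  refine lt_of_le_of_lt (le_of_eq (setLIntegral_congr_fun measurableSet_Ioi fun u hu => ?_)) h
  have hu' : 0 < u := hu
  simp only [← ofReal_norm, norm_mul, norm_pow, Complex.norm_real, Complex.norm_exp,
    Real.norm_eq_abs, abs_of_pos hu']
  congr 3
  simp
  ring

instance (k : ℕ) : IsFiniteMeasure (gammaWeightMeasure k) :=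
  isFiniteMeasure_withDensity (lintegral_gammaWeight_lt_top k).ne

theorem charFun_gammaWeightMeasure (k : ℕ) (ξ : ℝ) :
    charFun (gammaWeightMeasure k) ξ = k.factorial / (1 / 2 - ξ * Complex.I) ^ (k + 1) := by
  rw [charFun_apply_real, gammaWeightMeasure,
    integral_withDensity_eq_integral_toReal_smul (measurable_gammaWeight k)
      (ae_lt_top (measurable_gammaWeight k) (lintegral_gammaWeight_lt_top k).ne),
    ← integral_pow_mul_cexp k (by simp), ← integral_indicator measurableSet_Ioi]
  congr 1
  ext u
  by_cases hu : u ∈ Set.Ioi (0 : ℝ)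
  · have hu' : 0 < u := hu
    simp only [gammaWeight, Set.indicator_of_mem hu]
    rw [ENNReal.toReal_ofReal (by positivity), Complex.real_smul]
    push_cast
    rw [mul_assoc, ← Complex.exp_add]
    congr 2
    ring
  · simp [gammaWeight, Set.indicator_of_notMem hu]

/-- The unnormalised density of the difference of two independent gamma variables. -/
noncomputable def gammaDiffWeight (k : ℕ) (s : ℝ) : ℝ≥0∞ :=
  ∫⁻ t in Set.Ioi |s|, ENNReal.ofReal ((t ^ 2 - s ^ 2) ^ k * Real.exp (-t / 2))

@[fun_prop]
theorem measurable_gammaDiffWeight (k : ℕ) : Measurable (gammaDiffWeight k) := by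
  have : gammaDiffWeight k = fun s => ∫⁻ t, {p : ℝ × ℝ | |p.1| < p.2}.indicator
      (fun p => ENNReal.ofReal ((p.2 ^ 2 - p.1 ^ 2) ^ k * Real.exp (-p.2 / 2))) (s, t) := by
    ext s
    rw [gammaDiffWeight, ← lintegral_indicator measurableSet_Ioi]
    rfl
  rw [this]
  refine Measurable.lintegral_prod_right' (f := {p : ℝ × ℝ | |p.1| < p.2}.indicator
      (fun p => ENNReal.ofReal ((p.2 ^ 2 - p.1 ^ 2) ^ k * Real.exp (-p.2 / 2))))
    (Measurable.indicator (by fun_prop) (measurableSet_lt (by fun_prop) (by fun_prop)))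

/-- With t = 2u + s, the points u and u + s become (t-s)/2 and (t+s)/2, with sum t and product
(t²-s²)/4. This is what makes the convolution of two gamma weights explicit. -/
theorem lintegral_comp_half_sub (s : ℝ) {g : ℝ → ℝ≥0∞} (hg : Measurable g) :
    ∫⁻ u, g u = 2⁻¹ * ∫⁻ t, g ((t - s) / 2) := by
  have h1 : ∫⁻ t, g ((t - s) / 2) = ∫⁻ t, g (2⁻¹ * t) := by
    rw [← lintegral_sub_right_eq_self (fun t => g (2⁻¹ * t)) s]
    simp [div_eq_inv_mul]
  have h2 : ∫⁻ t, g (2⁻¹ * t) = 2 * ∫⁻ u, g u := by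
    rw [← lintegral_map (f := g) (g := fun t => 2⁻¹ * t) hg (by fun_prop),
      Real.map_volume_mul_left (by norm_num)]
    simp
  rw [h1, h2, ← mul_assoc, ENNReal.inv_mul_cancel (by simp) (by simp), one_mul]

theorem gammaWeight_mul_gammaWeight (k : ℕ) (s t : ℝ) :
    gammaWeight k ((t - s) / 2) * gammaWeight k ((t - s) / 2 + s) =
      (Set.Ioi |s|).indicator (fun t => ENNReal.ofReal ((4⁻¹) ^ k) *
        ENNReal.ofReal ((t ^ 2 - s ^ 2) ^ k * Real.exp (-t / 2))) t := by
  by_cases h : t ∈ Set.Ioi |s|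
  · obtain ⟨h1, h2⟩ := abs_lt.1 (Set.mem_Ioi.1 h)
    rw [Set.indicator_of_mem h, gammaWeight, Set.indicator_of_mem (by simp; linarith),
      Set.indicator_of_mem (by simp; linarith), ← ENNReal.ofReal_mul (by
        have : 0 < (t - s) / 2 := by linarith
        positivity), ← ENNReal.ofReal_mul (by positivity)]
    congr 1
    rw [mul_mul_mul_comm, ← mul_pow, ← Real.exp_add, ← mul_assoc ((4⁻¹ : ℝ) ^ k), ← mul_pow]
    congr 2 <;> ring
  · rw [Set.indicator_of_notMem h]
    by_cases h1 : s < t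
    · have h2 : ¬ (0 < (t - s) / 2 + s) := fun h3 => h (abs_lt.2 ⟨by linarith, h1⟩)
      simp [gammaWeight, Set.indicator_of_notMem (s := Set.Ioi (0 : ℝ)) h2]
    · have h2 : ¬ (0 < (t - s) / 2) := fun h3 => h1 (by linarith)
      simp [gammaWeight, Set.indicator_of_notMem (s := Set.Ioi (0 : ℝ)) h2]

theorem lintegral_gammaDiffWeight (k : ℕ) {g : ℝ → ℝ≥0∞} (hg : Measurable g) :
    ∫⁻ p : ℝ × ℝ, g (p.2 - p.1) ∂((gammaWeightMeasure k).prod (gammaWeightMeasure k)) =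
      2⁻¹ * ENNReal.ofReal ((4⁻¹) ^ k) * ∫⁻ s, g s * gammaDiffWeight k s := by
  rw [lintegral_prod _ (by fun_prop), gammaWeightMeasure,
    lintegral_withDensity_eq_lintegral_mul _ (by fun_prop)
      (Measurable.lintegral_prod_right' (f := fun p : ℝ × ℝ => g (p.2 - p.1)) (by fun_prop))]
  have h1 : ∀ u, ∫⁻ v, g (v - u) ∂(volume.withDensity (gammaWeight k)) =
      ∫⁻ s, gammaWeight k (s + u) * g s := by
    intro u
    rw [lintegral_withDensity_eq_lintegral_mul _ (by fun_prop) (by fun_prop),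
      ← lintegral_add_right_eq_self _ u]
    simp
  simp only [Pi.mul_apply, h1]
  have h3 : ∀ u, gammaWeight k u * ∫⁻ s, gammaWeight k (s + u) * g s =
      ∫⁻ s, gammaWeight k u * (gammaWeight k (s + u) * g s) :=
    fun u => (lintegral_const_mul _ (by fun_prop)).symm
  simp only [h3]
  rw [lintegral_lintegral_swap (by fun_prop), ← lintegral_const_mul _ (by fun_prop)]
  refine lintegral_congr fun s => ?_
  rw [lintegral_comp_half_sub s (by fun_prop)]
  have h2 : ∀ t, gammaWeight k ((t - s) / 2) * (gammaWeight k (s + (t - s) / 2) * g s) =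
      g s * (Set.Ioi |s|).indicator (fun t => ENNReal.ofReal ((4⁻¹) ^ k) *
        ENNReal.ofReal ((t ^ 2 - s ^ 2) ^ k * Real.exp (-t / 2))) t := by
    intro t
    rw [← gammaWeight_mul_gammaWeight, add_comm s]
    ring
  simp only [h2]
  rw [lintegral_const_mul _ (Measurable.indicator (by fun_prop) measurableSet_Ioi),
    lintegral_indicator measurableSet_Ioi, lintegral_const_mul _ (by fun_prop), gammaDiffWeight]
  ring

/-! ### Radial measures that project to gamma differences -/

/-- The radial profile of the law of a sum of `k + 1` Hopf images, as a function of the squared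
norm and up to normalisation. -/
noncomputable def hopfProfile : ℕ → ℝ → ℝ≥0∞
  | 0, w => ENNReal.ofReal (Real.exp (-√w / 2) / √w)
  | k + 1, w => ∫⁻ t in Set.Ioi √w, ENNReal.ofReal ((t ^ 2 - w) ^ k * Real.exp (-t / 2))

@[fun_prop]
theorem measurable_hopfProfile (k : ℕ) : Measurable (hopfProfile k) := by
  cases k with
  | zero =>
    change Measurable fun w => ENNReal.ofReal (Real.exp (-√w / 2) / √w)
    fun_prop
  | succ k =>
    have : hopfProfile (k + 1) = fun w => ∫⁻ t, {p : ℝ × ℝ | √p.1 < p.2}.indicator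
        (fun p => ENNReal.ofReal ((p.2 ^ 2 - p.1) ^ k * Real.exp (-p.2 / 2))) (w, t) := by
      ext w
      rw [hopfProfile, ← lintegral_indicator measurableSet_Ioi]
      rfl
    rw [this]
    refine Measurable.lintegral_prod_right' (f := {p : ℝ × ℝ | √p.1 < p.2}.indicator
        (fun p => ENNReal.ofReal ((p.2 ^ 2 - p.1) ^ k * Real.exp (-p.2 / 2))))
      (Measurable.indicator (by fun_prop) (measurableSet_lt (by fun_prop) (by fun_prop)))

theorem lintegral_Ioo_sub_pow (k : ℕ) {a b : ℝ} (hab : a ≤ b) :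
    ∫⁻ w in Set.Ioo a b, ENNReal.ofReal ((b - w) ^ k) =
      ENNReal.ofReal ((b - a) ^ (k + 1) / (k + 1)) := by
  rw [← setLIntegral_congr Ioo_ae_eq_Ioc.symm, ← ofReal_integral_eq_lintegral_ofReal,
    ← intervalIntegral.integral_of_le hab,
    intervalIntegral.integral_comp_sub_left (fun w => w ^ k) b]
  · simp
  · exact (intervalIntegrable_iff_integrableOn_Ioc_of_le hab).1
      (Continuous.intervalIntegrable (by fun_prop) _ _)
  · filter_upwards [ae_restrict_mem measurableSet_Ioc] with w hw
    exact pow_nonneg (sub_nonneg.2 hw.2) _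

/-- The line marginal of a radial density is the tail integral of its profile, so the profile has to
be an antiderivative in reverse. For positive index, Fubini leaves the integral of (t²-w)^k over s²
< w < t², which raises the exponent by one; for index zero the substitution w = t² suffices. -/
theorem exists_lintegral_hopfProfile (k : ℕ) : ∃ C : ℝ≥0∞, C ≠ 0 ∧ C ≠ ∞ ∧ ∀ s : ℝ,
    ∫⁻ w in Set.Ioi (s ^ 2), hopfProfile k w = C * gammaDiffWeight k s := by
  cases k with
  | zero =>
    refine ⟨2, by simp, by simp, fun s => ?_⟩
    rw [← sq_abs, lintegral_Ioi_sq (abs_nonneg s), gammaDiffWeight,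
      ← lintegral_const_mul _ (by fun_prop)]
    refine setLIntegral_congr_fun measurableSet_Ioi fun t ht => ?_
    have ht' : 0 < t := (abs_nonneg s).trans_lt ht
    simp only [hopfProfile, Real.sqrt_sq ht'.le, pow_zero, one_mul]
    rw [← ENNReal.ofReal_mul (by positivity), ← ENNReal.ofReal_ofNat 2,
      ← ENNReal.ofReal_mul (by positivity)]
    congr 1
    field_simp
  | succ k =>
    refine ⟨ENNReal.ofReal (1 / (k + 1)), by simp; positivity, by simp, fun s => ?_⟩
    -- The region w > s², t > √w is the same as t > |s|, s² < w < t².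
    have h1 : ∀ w t : ℝ, (Set.Ioi (s ^ 2)).indicator (fun w => (Set.Ioi √w).indicator
        (fun t => ENNReal.ofReal ((t ^ 2 - w) ^ k * Real.exp (-t / 2))) t) w =
        (Set.Ioi |s|).indicator (fun t => (Set.Ioo (s ^ 2) (t ^ 2)).indicator
        (fun w => ENNReal.ofReal ((t ^ 2 - w) ^ k * Real.exp (-t / 2))) w) t := by
      intro w t
      by_cases hw : s ^ 2 < w
      · by_cases ht : √w < t
        · have ht0 : 0 < t := (Real.sqrt_nonneg _).trans_lt ht
          have h2 : w < t ^ 2 := (Real.sqrt_lt' ht0).1 ht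
          have h3 : |s| < t := abs_lt_of_sq_lt_sq (hw.trans h2) ht0.le
          simp [Set.indicator, hw, ht, h2, h3]
        · by_cases h3 : |s| < t
          · have ht0 : 0 < t := (abs_nonneg s).trans_lt h3
            have h2 : ¬ w < t ^ 2 := fun h => ht ((Real.sqrt_lt' ht0).2 h)
            simp [Set.indicator, ht, h2]
          · simp [Set.indicator, ht, h3]
      · simp [Set.indicator, hw]
    have hm : Measurable (Function.uncurry fun w t : ℝ =>
        (Set.Ioi (s ^ 2)).indicator (fun w => (Set.Ioi √w).indicator
        (fun t => ENNReal.ofReal ((t ^ 2 - w) ^ k * Real.exp (-t / 2))) t) w) := by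
      have : (Function.uncurry fun w t : ℝ =>
          (Set.Ioi (s ^ 2)).indicator (fun w => (Set.Ioi √w).indicator
          (fun t => ENNReal.ofReal ((t ^ 2 - w) ^ k * Real.exp (-t / 2))) t) w) =
          ({p : ℝ × ℝ | s ^ 2 < p.1} ∩ {p : ℝ × ℝ | √p.1 < p.2}).indicator
          (fun p => ENNReal.ofReal ((p.2 ^ 2 - p.1) ^ k * Real.exp (-p.2 / 2))) := by
        ext p
        simp only [Set.indicator, Function.uncurry, Set.mem_Ioi, Set.mem_inter_iff,
          Set.mem_ofPred_eq]
        split_ifs <;> simp_all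
      rw [this]
      exact Measurable.indicator (by fun_prop) ((measurableSet_lt (by fun_prop) (by fun_prop)).inter
        (measurableSet_lt (by fun_prop) (by fun_prop)))
    calc ∫⁻ w in Set.Ioi (s ^ 2), hopfProfile (k + 1) w
        = ∫⁻ w, ∫⁻ t, (Set.Ioi (s ^ 2)).indicator (fun w => (Set.Ioi √w).indicator
          (fun t => ENNReal.ofReal ((t ^ 2 - w) ^ k * Real.exp (-t / 2))) t) w := by
          rw [← lintegral_indicator measurableSet_Ioi]
          refine lintegral_congr fun w => ?_
          by_cases hw : w ∈ Set.Ioi (s ^ 2)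
          · simp only [Set.indicator_of_mem hw]
            rw [lintegral_indicator measurableSet_Ioi, hopfProfile]
          · simp [Set.indicator_of_notMem hw]
      _ = ∫⁻ t, (Set.Ioi |s|).indicator (fun t => ∫⁻ w in Set.Ioo (s ^ 2) (t ^ 2),
          ENNReal.ofReal ((t ^ 2 - w) ^ k * Real.exp (-t / 2))) t := by
          rw [lintegral_lintegral_swap hm.aemeasurable]
          refine lintegral_congr fun t => ?_
          simp only [h1]
          by_cases ht : t ∈ Set.Ioi |s|
          · simp only [Set.indicator_of_mem ht]
            rw [lintegral_indicator measurableSet_Ioo]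
          · simp [Set.indicator_of_notMem ht]
      _ = ENNReal.ofReal (1 / (k + 1)) * gammaDiffWeight (k + 1) s := by
          rw [lintegral_indicator measurableSet_Ioi, gammaDiffWeight,
            ← lintegral_const_mul _ (by fun_prop)]
          refine setLIntegral_congr_fun measurableSet_Ioi fun t ht => ?_
          have h2 : s ^ 2 ≤ t ^ 2 := sq_le_sq.2 ((le_of_lt ht).trans (le_abs_self t))
          simp only [ENNReal.ofReal_mul' (Real.exp_nonneg _)]
          rw [lintegral_mul_const _ (by fun_prop), lintegral_Ioo_sub_pow k h2, ← mul_assoc,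
            ← ENNReal.ofReal_mul (p := 1 / ((k : ℝ) + 1)) (by positivity)]
          congr 2
          ring

/-- The unnormalised law of a sum of `k + 1` independent Hopf images of Gaussian quaternions. -/
noncomputable def hopfProfileMeasure (k : ℕ) : Measure (EuclideanSpace ℝ (Fin 3)) :=
  volume.withDensity fun x => hopfProfile k (‖x‖ ^ 2)

theorem exists_map_coord_hopfProfileMeasure (k : ℕ) : ∃ C : ℝ≥0∞, C ≠ 0 ∧ C ≠ ∞ ∧
    (hopfProfileMeasure k).map (fun x => x 0) =
      C • ((gammaWeightMeasure k).prod (gammaWeightMeasure k)).map (fun p => p.2 - p.1) := by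
  obtain ⟨C₁, h₁, h₁', H₁⟩ := exists_lintegral_coord_normSq
  obtain ⟨C₂, h₂, h₂', H₂⟩ := exists_lintegral_hopfProfile k
  obtain ⟨c, hc⟩ : ∃ c : ℝ≥0∞, c = 2⁻¹ * ENNReal.ofReal ((4⁻¹) ^ k) := ⟨_, rfl⟩
  have hc0 : c ≠ 0 := by rw [hc]; simp
  have hct : c ≠ ∞ := by rw [hc]; exact ENNReal.mul_ne_top (by simp) (by simp)
  refine ⟨C₁ * C₂ * c⁻¹, by simp [h₁, h₂, hct], by finiteness, ?_⟩
  refine Measure.ext_of_lintegral _ fun g hg => ?_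
  rw [lintegral_map hg (by fun_prop), lintegral_smul_measure, lintegral_map hg (by fun_prop),
    lintegral_gammaDiffWeight k hg, ← hc, hopfProfileMeasure,
    lintegral_withDensity_eq_lintegral_mul _ (by fun_prop) (by fun_prop)]
  simp only [Pi.mul_apply]
  rw [H₁ (fun s w => hopfProfile k w * g s) (by fun_prop)]
  have h3 : ∀ s, ∫⁻ w in Set.Ioi (s ^ 2), hopfProfile k w * g s =
      C₂ * (g s * gammaDiffWeight k s) := by
    intro s
    rw [lintegral_mul_const _ (by fun_prop), H₂]
    ring
  simp only [h3]
  rw [lintegral_const_mul _ (by fun_prop), smul_eq_mul, mul_assoc (C₁ * C₂), ← mul_assoc c⁻¹,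
    ENNReal.inv_mul_cancel hc0 hct, one_mul, mul_assoc]

instance (k : ℕ) : IsFiniteMeasure (hopfProfileMeasure k) := by
  obtain ⟨C, -, hC, h⟩ := exists_map_coord_hopfProfileMeasure k
  -- Projection preserves total mass, and the projected measure is a finite multiple of a finite
  -- one.
  have h2 : (hopfProfileMeasure k).map (fun x => x 0) Set.univ < ∞ := by
    rw [h, Measure.smul_apply]
    exact ENNReal.mul_lt_top hC.lt_top (measure_lt_top _ _)
  rw [Measure.map_apply (by fun_prop) MeasurableSet.univ] at h2
  exact ⟨h2⟩

theorem exists_linearIsometryEquiv_eq {F : Type*} [NormedAddCommGroup F] [InnerProductSpace ℝ F]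
    [FiniteDimensional ℝ F] {v w : F} (h : ‖v‖ = ‖w‖) : ∃ e : F ≃ₗᵢ[ℝ] F, e v = w :=
  ⟨_, Submodule.reflection_sub h⟩

/-- The density depends on the norm alone, so an isometry carrying the first axis to the direction
of ξ reduces the Fourier integral to the first coordinate. -/
theorem charFun_hopfProfileMeasure_eq_norm (k : ℕ) (ξ : EuclideanSpace ℝ (Fin 3)) :
    charFun (hopfProfileMeasure k) ξ =
      charFun ((hopfProfileMeasure k).map (fun x => x 0)) ‖ξ‖ := by
  obtain ⟨e, he⟩ := exists_linearIsometryEquiv_eq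
    (v := EuclideanSpace.single (0 : Fin 3) ‖ξ‖) (w := ξ) (by simp)
  have hmap : (hopfProfileMeasure k).map e = hopfProfileMeasure k := by
    refine Measure.ext_of_lintegral _ fun g hg => ?_
    rw [lintegral_map hg e.continuous.measurable, hopfProfileMeasure,
      lintegral_withDensity_eq_lintegral_mul _ (by fun_prop) 
        (show Measurable fun x => g (e x) from hg.comp e.continuous.measurable),
      lintegral_withDensity_eq_lintegral_mul _ (by fun_prop) hg,
      ← e.measurePreserving.lintegral_comp_emb e.toHomeomorph.measurableEmbedding
        ((fun x => hopfProfile k (‖x‖ ^ 2)) * g)]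
    simp
  rw [charFun_apply_real, charFun_apply]
  conv_lhs => rw [← hmap]
  rw [integral_map e.continuous.measurable.aemeasurable (by fun_prop),
    integral_map (by fun_prop) (by fun_prop)]
  refine integral_congr_ae (Eventually.of_forall fun x => ?_)
  simp only
  rw [← he, LinearIsometryEquiv.inner_map_map, LinearIsometryEquiv.norm_map]
  simp [EuclideanSpace.inner_single_right, mul_comm]

theorem exists_charFun_hopfProfileMeasure (k : ℕ) : ∃ A : ℝ, 0 < A ∧
    ∀ ξ, charFun (hopfProfileMeasure k) ξ = A * (1 / (1 + 4 * ‖ξ‖ ^ 2)) ^ (k + 1) := by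
  obtain ⟨C, hC0, hC, h⟩ := exists_map_coord_hopfProfileMeasure k
  have hC' : 0 < C.toReal := ENNReal.toReal_pos hC0 hC
  refine ⟨C.toReal * (k.factorial ^ 2 * 4 ^ (k + 1)), by positivity, fun ξ => ?_⟩
  rw [charFun_hopfProfileMeasure_eq_norm, h, charFun_apply_real, integral_smul_measure,
    integral_map (by fun_prop) (by fun_prop)]
  obtain ⟨t, ht⟩ : ∃ t : ℝ, t = ‖ξ‖ := ⟨_, rfl⟩
  rw [← ht]
  have h1 : ∫ p : ℝ × ℝ, Complex.exp (t * ((p.2 - p.1 : ℝ) : ℂ) * Complex.I)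
      ∂((gammaWeightMeasure k).prod (gammaWeightMeasure k)) =
      charFun (gammaWeightMeasure k) (-t) * charFun (gammaWeightMeasure k) t := by
    rw [charFun_apply_real, charFun_apply_real, ← integral_prod_mul]
    refine integral_congr_ae (Eventually.of_forall fun p => ?_)
    simp only
    rw [← Complex.exp_add]
    congr 1
    push_cast
    ring
  rw [h1, charFun_gammaWeightMeasure, charFun_gammaWeightMeasure, div_mul_div_comm, ← mul_pow]
  have h2 : (1 / 2 - ((-t : ℝ) : ℂ) * Complex.I) * (1 / 2 - t * Complex.I) =
      (1 + 4 * (t : ℂ) ^ 2) / 4 := by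
    push_cast
    linear_combination (-(t : ℂ) ^ 2) * Complex.I_sq
  rw [h2, div_pow, one_div, inv_pow, Complex.real_smul]
  have h3 : (1 + 4 * (t : ℂ) ^ 2) ≠ 0 := by
    have : (1 + 4 * t ^ 2) ≠ 0 := by positivity
    exact_mod_cast this
  push_cast
  field_simp

/-! ### The law of one edge and of a sum of edges -/

/-- The law of the Hopf image of a standard Gaussian quaternion. -/
noncomputable def hopfLaw : Measure (EuclideanSpace ℝ (Fin 3)) :=
  (Measure.pi fun _ : Fin 4 => gaussianReal 0 1).map
    fun x => hopf ((Quaternion.equivTuple ℝ).symm x)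

theorem hopf_equivTuple_symm (x : Fin 4 → ℝ) :
    hopf ((Quaternion.equivTuple ℝ).symm x) =
      !₂[x 0 ^ 2 + x 1 ^ 2 - x 2 ^ 2 - x 3 ^ 2,
        2 * x 1 * x 2 - 2 * x 0 * x 3, 2 * x 0 * x 2 + 2 * x 1 * x 3] :=
  hopf_apply _

theorem measurable_hopf_equivTuple_symm :
    Measurable fun x : Fin 4 → ℝ => hopf ((Quaternion.equivTuple ℝ).symm x) := by
  simp only [hopf_equivTuple_symm]
  refine (MeasurableEquiv.toLp 2 (Fin 3 → ℝ)).measurable.comp (measurable_pi_lambda _ fun i => ?_)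
  fin_cases i <;> simp <;> fun_prop

instance : IsProbabilityMeasure hopfLaw :=
  Measure.isProbabilityMeasure_map measurable_hopf_equivTuple_symm.aemeasurable

theorem pi_fin_four_eq_map_prod {α : Type*} [MeasurableSpace α] (γ : Measure α) [SigmaFinite γ] :
    (Measure.pi fun _ : Fin 4 => γ) =
      ((γ.prod γ).prod (γ.prod γ)).map fun p => ![p.1.1, p.1.2, p.2.1, p.2.2] := by
  refine Measure.pi_eq fun s hs => ?_
  have hm : Measurable fun p : (α × α) × (α × α) => ![p.1.1, p.1.2, p.2.1, p.2.2] := by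
    refine measurable_pi_lambda _ fun i => ?_
    fin_cases i <;> simp <;> fun_prop
  rw [Measure.map_apply hm (MeasurableSet.univ_pi hs)]
  have : (fun p : (α × α) × (α × α) => ![p.1.1, p.1.2, p.2.1, p.2.2]) ⁻¹' Set.univ.pi s =
      (s 0 ×ˢ s 1) ×ˢ (s 2 ×ˢ s 3) := by
    ext p
    simp [Set.mem_pi, Fin.forall_fin_succ, and_assoc]
  rw [this, Measure.prod_prod, Measure.prod_prod, Measure.prod_prod, Fin.prod_univ_four]
  ring

/-- A single integral carries a complex square root of 1/(1-2β). Two integrals with the same β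
multiply to an honest inverse, so no branch has to be tracked. -/
theorem integral_cexp_quadratic_gaussianReal_mul {β : ℂ} (hβ : β.re < 1 / 2) (c d : ℂ) :
    (∫ x, Complex.exp (β * x ^ 2 + c * x) ∂(gaussianReal 0 1)) *
      (∫ x, Complex.exp (β * x ^ 2 + d * x) ∂(gaussianReal 0 1)) =
      (1 - 2 * β)⁻¹ * Complex.exp ((c ^ 2 + d ^ 2) / (2 * (1 - 2 * β))) := by
  have hb : (β - 1 / 2).re < 0 := by simp at hβ ⊢; linarith
  have hb0 : β - 1 / 2 ≠ 0 := by intro h; rw [h] at hb; simp at hb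
  have hb1 : 1 - 2 * β ≠ 0 := by
    intro h; apply hb0; linear_combination (-1 / 2) * h
  have h1 : ∀ c : ℂ, ∫ x, Complex.exp (β * x ^ 2 + c * x) ∂(gaussianReal 0 1) =
      ((√(2 * Real.pi))⁻¹ : ℝ) * ((Real.pi / -(β - 1 / 2)) ^ (1 / 2 : ℂ) *
        Complex.exp (c ^ 2 / (2 * (1 - 2 * β)))) := by
    intro c
    have h2 := integral_cexp_quadratic hb c 0
    rw [integral_gaussianReal_eq_integral_smul one_ne_zero]
    have h3 : (0 - c ^ 2 / (4 * (β - 1 / 2))) = c ^ 2 / (2 * (1 - 2 * β)) := by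
      rw [show 4 * (β - 1 / 2) = -(2 * (1 - 2 * β)) by ring, div_neg]
      ring
    rw [← h3, ← h2, ← integral_const_mul]
    refine integral_congr_ae (Eventually.of_forall fun x => ?_)
    simp only [gaussianPDFReal, Complex.real_smul]
    push_cast
    rw [mul_assoc, ← Complex.exp_add]
    simp
    left
    ring_nf
  rw [h1, h1]
  have h4 : ∀ z : ℂ, z ^ (1 / 2 : ℂ) * z ^ (1 / 2 : ℂ) = z := by
    intro z
    by_cases hz : z = 0
    · simp [hz]
    · rw [← Complex.cpow_add _ _ hz]; norm_num
  have h5 : (((√(2 * Real.pi))⁻¹ : ℝ) : ℂ) * ((√(2 * Real.pi))⁻¹ : ℝ) =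
      (2 * (Real.pi : ℂ))⁻¹ := by
    rw [← Complex.ofReal_mul, ← mul_inv, Real.mul_self_sqrt (by positivity)]
    simp
  rw [mul_mul_mul_comm, h5, mul_mul_mul_comm, h4, ← Complex.exp_add, ← mul_assoc, ← add_div]
  congr 1
  have hpi : (Real.pi : ℂ) ≠ 0 := by exact_mod_cast Real.pi_ne_zero
  rw [show -(β - 1 / 2) = (1 - 2 * β) / 2 by ring]
  field_simp

/-- With ξ = (a, b, c) the phase is a quadratic form in the four coordinates. Integrating out the
last two gives Gaussian integrals with β = -ai, and completing the square leaves two more with β =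
ai - 2(b²+c²)/(1+2ai). The product of the prefactors is the inverse of (1+2ai)(1-2ai) + 4(b²+c²) = 1
+ 4|ξ|². -/
theorem charFun_hopfLaw (ξ : EuclideanSpace ℝ (Fin 3)) :
    charFun hopfLaw ξ = 1 / (1 + 4 * ‖ξ‖ ^ 2) := by
  obtain ⟨a, ha⟩ : ∃ a : ℝ, a = ξ 0 := ⟨_, rfl⟩
  obtain ⟨b, hb⟩ : ∃ b : ℝ, b = ξ 1 := ⟨_, rfl⟩
  obtain ⟨c, hc⟩ : ∃ c : ℝ, c = ξ 2 := ⟨_, rfl⟩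
  have hm : Measurable fun p : (ℝ × ℝ) × (ℝ × ℝ) => ![p.1.1, p.1.2, p.2.1, p.2.2] := by
    refine measurable_pi_lambda _ fun i => ?_
    fin_cases i <;> simp <;> fun_prop
  have hm' : Measurable fun x : Fin 4 → ℝ => Complex.exp
      ((inner ℝ (hopf ((Quaternion.equivTuple ℝ).symm x)) ξ : ℝ) * Complex.I) :=
    (by fun_prop : Continuous fun x : EuclideanSpace ℝ (Fin 3) =>
      Complex.exp ((inner ℝ x ξ : ℝ) * Complex.I)).measurable.comp measurable_hopf_equivTuple_symm
  have h1 : charFun hopfLaw ξ = ∫ p : (ℝ × ℝ) × (ℝ × ℝ),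
      Complex.exp (((a * (p.1.1 ^ 2 + p.1.2 ^ 2 - p.2.1 ^ 2 - p.2.2 ^ 2) +
        b * (2 * p.1.2 * p.2.1 - 2 * p.1.1 * p.2.2) +
        c * (2 * p.1.1 * p.2.1 + 2 * p.1.2 * p.2.2) : ℝ) : ℂ) * Complex.I)
      ∂(((gaussianReal 0 1).prod (gaussianReal 0 1)).prod
        ((gaussianReal 0 1).prod (gaussianReal 0 1))) := by
    rw [charFun_apply, hopfLaw, integral_map measurable_hopf_equivTuple_symm.aemeasurable
      (by fun_prop), pi_fin_four_eq_map_prod, integral_map hm.aemeasurable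
      hm'.aestronglyMeasurable]
    refine integral_congr_ae (Eventually.of_forall fun p => ?_)
    simp only [hopf_equivTuple_symm, PiLp.inner_apply, Fin.sum_univ_three, ha, hb, hc]
    simp
  have hne : 1 + 2 * a * Complex.I ≠ 0 := by
    intro h
    have := congrArg Complex.re h
    simp at this
  have h2 : ∀ q : ℝ × ℝ, ∫ r : ℝ × ℝ,
      Complex.exp (((a * (q.1 ^ 2 + q.2 ^ 2 - r.1 ^ 2 - r.2 ^ 2) +
        b * (2 * q.2 * r.1 - 2 * q.1 * r.2) +
        c * (2 * q.1 * r.1 + 2 * q.2 * r.2) : ℝ) : ℂ) * Complex.I)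
      ∂((gaussianReal 0 1).prod (gaussianReal 0 1)) =
      (1 + 2 * a * Complex.I)⁻¹ *
        (Complex.exp ((a * Complex.I - 2 * (b ^ 2 + c ^ 2) / (1 + 2 * a * Complex.I)) * q.1 ^ 2
          + 0 * q.1) *
        Complex.exp ((a * Complex.I - 2 * (b ^ 2 + c ^ 2) / (1 + 2 * a * Complex.I)) * q.2 ^ 2
          + 0 * q.2)) := by
    intro q
    have h3 := integral_cexp_quadratic_gaussianReal_mul (β := -a * Complex.I) (by simp)
      (2 * (b * q.2 + c * q.1) * Complex.I) (2 * (c * q.2 - b * q.1) * Complex.I)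
    rw [← integral_prod_mul] at h3
    have h4 : Complex.exp (a * (q.1 ^ 2 + q.2 ^ 2) * Complex.I) *
        ((1 - 2 * (-a * Complex.I))⁻¹ * Complex.exp
        (((2 * (b * q.2 + c * q.1) * Complex.I) ^ 2 + (2 * (c * q.2 - b * q.1) * Complex.I) ^ 2) /
          (2 * (1 - 2 * (-a * Complex.I))))) = (1 + 2 * a * Complex.I)⁻¹ *
        (Complex.exp ((a * Complex.I - 2 * (b ^ 2 + c ^ 2) / (1 + 2 * a * Complex.I)) * q.1 ^ 2
          + 0 * q.1) *
        Complex.exp ((a * Complex.I - 2 * (b ^ 2 + c ^ 2) / (1 + 2 * a * Complex.I)) * q.2 ^ 2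
          + 0 * q.2)) := by
      have h5 : 1 - 2 * (-a * Complex.I) = 1 + 2 * a * Complex.I := by ring
      rw [h5, mul_left_comm, ← Complex.exp_add, ← Complex.exp_add]
      congr 2
      simp only [mul_pow, Complex.I_sq]
      field_simp
      ring
    rw [← h4, ← h3, ← integral_const_mul]
    refine integral_congr_ae (Eventually.of_forall fun r => ?_)
    simp only
    rw [← Complex.exp_add, ← Complex.exp_add]
    congr 1
    push_cast
    ring
  have hint : Integrable (fun p : (ℝ × ℝ) × (ℝ × ℝ) =>
      Complex.exp (((a * (p.1.1 ^ 2 + p.1.2 ^ 2 - p.2.1 ^ 2 - p.2.2 ^ 2) +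
        b * (2 * p.1.2 * p.2.1 - 2 * p.1.1 * p.2.2) +
        c * (2 * p.1.1 * p.2.1 + 2 * p.1.2 * p.2.2) : ℝ) : ℂ) * Complex.I))
      (((gaussianReal 0 1).prod (gaussianReal 0 1)).prod
        ((gaussianReal 0 1).prod (gaussianReal 0 1))) := by
    refine Integrable.of_bound (by fun_prop) 1 (Eventually.of_forall fun p => ?_)
    rw [Complex.norm_exp_ofReal_mul_I]
  -- The real part is -2(b²+c²)/(1+4a²) ≤ 0, visible after rationalising the denominator.
  have hβ : (a * Complex.I - 2 * (b ^ 2 + c ^ 2) / (1 + 2 * a * Complex.I)).re < 1 / 2 := by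
    have : (2 * ((b : ℂ) ^ 2 + c ^ 2) / (1 + 2 * a * Complex.I)) =
        ((2 * (b ^ 2 + c ^ 2) / (1 + 4 * a ^ 2) : ℝ) : ℂ) * (1 - 2 * a * Complex.I) := by
      have h6 : (1 + 4 * (a : ℂ) ^ 2) ≠ 0 := by
        have : (1 + 4 * a ^ 2) ≠ 0 := by positivity
        exact_mod_cast this
      have h8 : (1 - 2 * a * Complex.I) * (1 + 2 * a * Complex.I) = 1 + 4 * (a : ℂ) ^ 2 := by
        linear_combination (-4 * (a : ℂ) ^ 2) * Complex.I_sq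
      rw [div_eq_iff hne, mul_assoc, h8]
      push_cast
      field_simp
    rw [this, Complex.sub_re, Complex.re_ofReal_mul, Complex.re_ofReal_mul]
    have h7 : 0 ≤ 2 * (b ^ 2 + c ^ 2) / (1 + 4 * a ^ 2) := by positivity
    have h9 : (1 - 2 * a * Complex.I).re = 1 := by simp
    rw [h9, Complex.I_re]
    linarith
  rw [h1, integral_prod _ hint]
  simp only [h2]
  rw [integral_const_mul, integral_prod_mul
    (fun x : ℝ => Complex.exp ((a * Complex.I - 2 * (b ^ 2 + c ^ 2) / (1 + 2 * a * Complex.I)) *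
      x ^ 2 + 0 * x)) (fun x : ℝ => Complex.exp ((a * Complex.I - 2 * (b ^ 2 + c ^ 2) /
      (1 + 2 * a * Complex.I)) * x ^ 2 + 0 * x)),
    integral_cexp_quadratic_gaussianReal_mul hβ]
  simp only [ne_eq, OfNat.ofNat_ne_zero, not_false_eq_true, zero_pow, add_zero, zero_div,
    Complex.exp_zero, mul_one]
  rw [← mul_inv, one_div]
  congr 1
  have hn : (‖ξ‖ : ℂ) ^ 2 = a ^ 2 + b ^ 2 + c ^ 2 := by
    rw [← Complex.ofReal_pow, EuclideanSpace.norm_sq_eq, Fin.sum_univ_three, ← ha, ← hb, ← hc]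
    simp only [Real.norm_eq_abs, sq_abs]
    push_cast
    rfl
  rw [hn]
  field_simp
  linear_combination (-4 * (a : ℂ) ^ 2) * (Complex.I_sq)

/-- Finite measures with proportional characteristic functions are proportional. This yields
densities without a Jacobian of the Hopf map or an iterated convolution. -/
theorem exists_eq_smul_hopfProfileMeasure (k : ℕ) (μ : Measure (EuclideanSpace ℝ (Fin 3)))
    [IsFiniteMeasure μ] (hμ : ∀ ξ, charFun μ ξ = (1 / (1 + 4 * ‖ξ‖ ^ 2)) ^ (k + 1)) :
    ∃ a : ℝ≥0∞, a ≠ 0 ∧ a ≠ ∞ ∧ μ = a • hopfProfileMeasure k := by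
  obtain ⟨A, hA, h⟩ := exists_charFun_hopfProfileMeasure k
  refine ⟨(ENNReal.ofReal A)⁻¹, by simp, by simpa, ?_⟩
  have h1 : hopfProfileMeasure k = ENNReal.ofReal A • μ := by
    have : IsFiniteMeasure (ENNReal.ofReal A • μ) := μ.smul_finite ENNReal.ofReal_ne_top
    refine Measure.ext_of_charFun (funext fun ξ => ?_)
    rw [h, ← hμ, charFun_apply, charFun_apply, integral_smul_measure,
      ENNReal.toReal_ofReal hA.le, Complex.real_smul]
  rw [h1, smul_smul, ENNReal.inv_mul_cancel (by simpa) ENNReal.ofReal_ne_top, one_smul]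

theorem exists_hopfLaw_eq_smul :
    ∃ a : ℝ≥0∞, a ≠ 0 ∧ a ≠ ∞ ∧ hopfLaw = a • hopfProfileMeasure 0 :=
  exists_eq_smul_hopfProfileMeasure 0 _ fun ξ => by rw [charFun_hopfLaw, zero_add, pow_one]

theorem exists_map_sum_pi_hopfLaw_eq_smul (k : ℕ) : ∃ a : ℝ≥0∞, a ≠ 0 ∧ a ≠ ∞ ∧
    (Measure.pi fun _ : Fin (k + 1) => hopfLaw).map (fun x => ∑ i, x i) =
      a • hopfProfileMeasure k := by
  refine exists_eq_smul_hopfProfileMeasure k _ fun ξ => ?_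
  have h : ∀ x : Fin (k + 1) → EuclideanSpace ℝ (Fin 3),
      Complex.exp ((inner ℝ (∑ i, x i) ξ : ℝ) * Complex.I) =
        ∏ i, Complex.exp ((inner ℝ (x i) ξ : ℝ) * Complex.I) := by
    intro x
    rw [← Complex.exp_sum, sum_inner, Complex.ofReal_sum, Finset.sum_mul]
  rw [charFun_apply, integral_map (by fun_prop) (by fun_prop)]
  simp only [h]
  rw [integral_fintype_prod_eq_pow fun x : EuclideanSpace ℝ (Fin 3) =>
    Complex.exp ((inner ℝ x ξ : ℝ) * Complex.I), ← charFun_apply, charFun_hopfLaw, Fintype.card_fin]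

/-! ### The density on arms -/

theorem lintegral_fin_prod_eq_prod {n : ℕ} {α : Type*} [MeasurableSpace α]
    {μ : Fin n → Measure α} [∀ i, SigmaFinite (μ i)] {f : Fin n → α → ℝ≥0∞}
    (hf : ∀ i, Measurable (f i)) :
    ∫⁻ x, ∏ i, f i (x i) ∂Measure.pi μ = ∏ i, ∫⁻ x, f i x ∂μ i := by
  induction n with
  | zero => simp
  | succ n ih =>
    have hm : Measurable fun x : Fin n → α => ∏ i, f i.succ (x i) :=
      Finset.measurable_prod _ fun i _ => (hf _).comp (measurable_pi_apply i)
    rw [← (measurePreserving_piFinSuccAbove μ 0).symm.lintegral_comp_emb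
      (MeasurableEquiv.measurableEmbedding _)]
    simp only [Fin.prod_univ_succ, MeasurableEquiv.piFinSuccAbove_symm_apply,
      Fin.insertNthEquiv_zero, Fin.consEquiv_apply, Fin.cons_zero, Fin.cons_succ]
    have := lintegral_prod_mul (μ := μ 0) (ν := Measure.pi fun i : Fin n => μ i.succ)
      (hf 0).aemeasurable hm.aemeasurable
    rw [ih fun i => hf _] at this
    exact this

theorem pi_withDensity {n : ℕ} {α : Type*} [MeasurableSpace α] (μ : Measure α) [SigmaFinite μ]
    {g : α → ℝ≥0∞} (hg : Measurable g) [SigmaFinite (μ.withDensity g)] :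
    Measure.pi (fun _ : Fin n => μ.withDensity g) =
      (Measure.pi fun _ : Fin n => μ).withDensity fun x => ∏ i, g (x i) := by
  refine Measure.pi_eq fun s hs => ?_
  rw [withDensity_apply _ (MeasurableSet.univ_pi hs), Measure.restrict_pi_pi,
    lintegral_fin_prod_eq_prod fun _ => hg]
  exact Finset.prod_congr rfl fun i _ => (withDensity_apply _ (hs i)).symm

/-- The density of the law of the Hopf image of a Gaussian quaternion, up to normalisation. -/
noncomputable def hopfDensity (x : EuclideanSpace ℝ (Fin 3)) : ℝ≥0∞ :=
  ENNReal.ofReal (Real.exp (-‖x‖ / 2) / ‖x‖)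

@[fun_prop]
theorem measurable_hopfDensity : Measurable hopfDensity := by
  unfold hopfDensity
  fun_prop

theorem hopfProfileMeasure_zero : hopfProfileMeasure 0 = volume.withDensity hopfDensity := by
  simp only [hopfProfileMeasure, hopfProfile, Real.sqrt_sq (norm_nonneg _)]
  rfl

theorem hopfGaussianArm_eq_map_pi (n : ℕ) :
    hopfGaussianArm n = (Measure.pi fun _ : Fin n => hopfLaw).map (WithLp.toLp 2) := by
  have h : (Measure.pi fun _ : Fin n => hopfLaw) = (quaternionGaussian n).map
      fun x i => hopf ((Quaternion.equivTuple ℝ).symm (x i)) := by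
    have : ∀ _ : Fin n, SigmaFinite ((Measure.pi fun _ : Fin 4 => gaussianReal 0 1).map
        fun x => hopf ((Quaternion.equivTuple ℝ).symm x)) :=
      fun _ => inferInstanceAs (SigmaFinite hopfLaw)
    exact (Measure.pi_map_pi (μ := fun _ : Fin n => Measure.pi fun _ : Fin 4 => gaussianReal 0 1)
      fun _ => measurable_hopf_equivTuple_symm.aemeasurable).symm
  rw [h, hopfGaussianArm, Measure.map_map]
  · rfl
  · exact (MeasurableEquiv.toLp 2 (Fin n → EuclideanSpace ℝ (Fin 3))).measurable
  · exact measurable_pi_lambda _ fun i => measurable_hopf_equivTuple_symm.comp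
      (measurable_pi_apply i)

theorem exists_eq_smul_of_isAddHaarMeasure {G : Type*} [AddGroup G] [TopologicalSpace G]
    [IsTopologicalAddGroup G] [MeasurableSpace G] [BorelSpace G] [LocallyCompactSpace G]
    [SecondCountableTopology G] (μ ν : Measure G) [μ.IsAddHaarMeasure] [ν.IsAddHaarMeasure] :
    ∃ c : ℝ≥0∞, c ≠ 0 ∧ c ≠ ∞ ∧ μ = c • ν :=
  ⟨μ.addHaarScalarFactor ν,
    ENNReal.coe_ne_zero.2 (Measure.addHaarScalarFactor_pos_of_isAddHaarMeasure μ ν).ne',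
    ENNReal.coe_ne_top, Measure.isAddLeftInvariant_eq_smul μ ν⟩

theorem exists_hopfGaussianArm_eq_withDensity (n : ℕ) : ∃ C : ℝ≥0∞, C ≠ 0 ∧ C ≠ ∞ ∧
    hopfGaussianArm n = volume.withDensity fun e => C * ∏ i, hopfDensity (e i) := by
  obtain ⟨a, ha0, ha, h⟩ := exists_hopfLaw_eq_smul
  have : ((volume : Measure (Fin n → EuclideanSpace ℝ (Fin 3))).map
      (WithLp.toLp 2)).IsAddHaarMeasure :=
    (PiLp.continuousLinearEquiv 2 ℝ
      fun _ : Fin n => EuclideanSpace ℝ (Fin 3)).symm.isAddHaarMeasure_map volume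
  -- Lebesgue measure on `Arm n` and the product of the Lebesgue measures are compared only by
  -- uniqueness of Haar measure; the factor cancels later.
  obtain ⟨b, hb0, hb, hv⟩ := exists_eq_smul_of_isAddHaarMeasure
    ((volume : Measure (Fin n → EuclideanSpace ℝ (Fin 3))).map (WithLp.toLp 2))
    (volume : Measure (Arm n))
  have hlaw : hopfLaw = volume.withDensity fun x => a * hopfDensity x := by
    rw [h, hopfProfileMeasure_zero, ← withDensity_smul _ measurable_hopfDensity]
    rfl
  have : SigmaFinite (volume.withDensity fun x => a * hopfDensity x) := by
    rw [← hlaw]; infer_instance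
  refine ⟨a ^ n * b, by positivity, by finiteness, ?_⟩
  have hD : Measurable fun e : Arm n => ∏ i, hopfDensity (e i) := by fun_prop
  have hL : Measurable (WithLp.toLp 2 : (Fin n → EuclideanSpace ℝ (Fin 3)) → Arm n) :=
    (MeasurableEquiv.toLp 2 (Fin n → EuclideanSpace ℝ (Fin 3))).measurable
  refine Measure.ext_of_lintegral _ fun g hg => ?_
  rw [hopfGaussianArm_eq_map_pi, hlaw, pi_withDensity _ (by fun_prop),
    lintegral_map hg hL, lintegral_withDensity_eq_lintegral_mul _ (by fun_prop)
      (show Measurable fun x => g (WithLp.toLp 2 x) from hg.comp hL),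
    lintegral_withDensity_eq_lintegral_mul _ (by fun_prop) hg]
  have h1 : ∫⁻ e : Arm n, (∏ i, hopfDensity (e i)) * g e
      ∂((volume : Measure (Fin n → EuclideanSpace ℝ (Fin 3))).map (WithLp.toLp 2)) =
      b * ∫⁻ e : Arm n, (∏ i, hopfDensity (e i)) * g e := by
    rw [hv, lintegral_smul_measure, smul_eq_mul]
  rw [lintegral_map (by fun_prop) hL] at h1
  simp only [Pi.mul_apply, Finset.prod_mul_distrib, Finset.prod_const, Finset.card_univ,
    Fintype.card_fin, mul_assoc]
  rw [lintegral_const_mul _ (by fun_prop), lintegral_const_mul _ (by fun_prop),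
    lintegral_const_mul _ (by fun_prop), ← h1]
  rfl

theorem continuousAt_prod_hopfDensity {n : ℕ} {e : Arm n} (he : ∀ i, e i ≠ 0) :
    ContinuousAt (fun e : Arm n => ∏ i, hopfDensity (e i)) e := by
  have h : (fun e : Arm n => ∏ i, hopfDensity (e i)) =
      fun e => ENNReal.ofReal (∏ i, Real.exp (-‖e i‖ / 2) / ‖e i‖) := by
    ext e
    rw [ENNReal.ofReal_prod_of_nonneg fun i _ => by positivity]
    rfl
  rw [h]
  refine ENNReal.continuous_ofReal.continuousAt.comp (tendsto_finsetProd _ fun i _ => ?_)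
  refine ContinuousAt.div (by fun_prop) (by fun_prop) (norm_ne_zero_iff.2 (he i))

/-- By continuity, any strict bounds around F x hold on a small ball, hence weakly for its averages
there; so the upper limit is a limit. -/
theorem pointDensity_withDensity {E : Type*} [NormedAddCommGroup E] [InnerProductSpace ℝ E]
    [FiniteDimensional ℝ E] [MeasurableSpace E] [BorelSpace E] {F : E → ℝ≥0∞} {x : E}
    (hF : ContinuousAt F x) : pointDensity (volume.withDensity F) x = F x := by
  refine Tendsto.limsup_eq ?_
  have hball : ∀ᶠ ε : ℝ in 𝓝[>] 0, volume.withDensity F (Metric.ball x ε) / volume (Metric.ball x ε)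
      = (∫⁻ y in Metric.ball x ε, F y) / volume (Metric.ball x ε) :=
    Eventually.of_forall fun ε => by rw [withDensity_apply _ measurableSet_ball]
  have hsub : ∀ U ∈ 𝓝 x, ∀ᶠ ε : ℝ in 𝓝[>] 0, Metric.ball x ε ⊆ U := by
    intro U hU
    obtain ⟨δ, hδ, h⟩ := Metric.mem_nhds_iff.1 hU
    filter_upwards [Ioo_mem_nhdsGT hδ] with ε hε
    exact (Metric.ball_subset_ball hε.2.le).trans h
  refine tendsto_order.2 ⟨fun a ha => ?_, fun b hb => ?_⟩
  · obtain ⟨c, hac, hc⟩ := exists_between ha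
    filter_upwards [hball, hsub _ (hF.eventually (lt_mem_nhds hc)), self_mem_nhdsWithin]
      with ε h1 h2 h3
    have hpos : 0 < volume (Metric.ball x ε) := Metric.measure_ball_pos _ _ h3
    rw [h1]
    refine hac.trans_le ((ENNReal.le_div_iff_mul_le (.inl hpos.ne')
      (.inl measure_ball_lt_top.ne)).2 ?_)
    rw [← setLIntegral_const]
    exact setLIntegral_mono' measurableSet_ball fun y hy => (h2 hy).le
  · obtain ⟨c, hc, hcb⟩ := exists_between hb
    filter_upwards [hball, hsub _ (hF.eventually (gt_mem_nhds hc)), self_mem_nhdsWithin]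
      with ε h1 h2 h3
    have hpos : 0 < volume (Metric.ball x ε) := Metric.measure_ball_pos _ _ h3
    rw [h1]
    refine lt_of_le_of_lt ((ENNReal.div_le_iff_le_mul (.inl hpos.ne')
      (.inl measure_ball_lt_top.ne)).2 ?_) hcb
    rw [← setLIntegral_const]
    exact setLIntegral_mono' measurableSet_ball fun y hy => (h2 hy).le

/-! ### Hausdorff measure on closed polygons and the marginal of an edge -/

theorem mem_closedPolygons {n : ℕ} {e : Arm n} : e ∈ closedPolygons n ↔ ∑ i, e i = 0 := Iff.rfl

/-- A closed polygon is determined by all of its edges but one. -/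
noncomputable def closedPolygonsEquiv {m : ℕ} (i : Fin (m + 1)) :
    (Fin m → EuclideanSpace ℝ (Fin 3)) ≃ₗ[ℝ] closedPolygons (m + 1) where
  toFun x := ⟨WithLp.toLp 2 (Fin.insertNth i (-∑ j, x j) x), by
    rw [mem_closedPolygons, Fin.sum_univ_succAbove _ i]
    simp⟩
  invFun e j := (e : Arm (m + 1)) (i.succAbove j)
  left_inv x := by ext1 j; simp
  right_inv e := by
    have h := mem_closedPolygons.1 e.2
    rw [Fin.sum_univ_succAbove _ i] at h
    ext1
    refine PiLp.ext fun j => ?_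
    refine Fin.succAboveCases i ?_ (fun j => ?_) j
    · simp only [Fin.insertNth_apply_same]
      exact (eq_neg_of_add_eq_zero_left h).symm
    · simp
  map_add' x y := by
    ext1
    refine PiLp.ext fun j => ?_
    refine Fin.succAboveCases i ?_ (fun j => ?_) j
    · simp only [Submodule.coe_add, PiLp.add_apply, Fin.insertNth_apply_same, Pi.add_apply,
        Finset.sum_add_distrib, neg_add]
    · simp only [Submodule.coe_add, PiLp.add_apply, Fin.insertNth_apply_succAbove, Pi.add_apply]
  map_smul' c x := by
    ext1
    refine PiLp.ext fun j => ?_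
    refine Fin.succAboveCases i ?_ (fun j => ?_) j
    · simp only [Submodule.coe_smul, PiLp.smul_apply, Fin.insertNth_apply_same, Pi.smul_apply,
        Finset.smul_sum, smul_neg, RingHom.id_apply]
    · simp only [Submodule.coe_smul, PiLp.smul_apply, Fin.insertNth_apply_succAbove,
        Pi.smul_apply, RingHom.id_apply]

@[simp]
theorem closedPolygonsEquiv_apply_same {m : ℕ} (i : Fin (m + 1))
    (x : Fin m → EuclideanSpace ℝ (Fin 3)) :
    (closedPolygonsEquiv i x : Arm (m + 1)) i = -∑ j, x j := by
  simp [closedPolygonsEquiv]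

@[simp]
theorem closedPolygonsEquiv_apply_succAbove {m : ℕ} (i : Fin (m + 1))
    (x : Fin m → EuclideanSpace ℝ (Fin 3)) (j : Fin m) :
    (closedPolygonsEquiv i x : Arm (m + 1)) (i.succAbove j) = x j := by
  simp [closedPolygonsEquiv]

section Submodule

variable {E : Type*} [NormedAddCommGroup E] [InnerProductSpace ℝ E] [MeasurableSpace E]
  [BorelSpace E]

theorem hausdorffMeasure_restrict_submodule_eq_map (S : Submodule ℝ E) :
    (Measure.hausdorffMeasure (Module.finrank ℝ S : ℝ)).restrict (S : Set E) =
      (Measure.hausdorffMeasure (Module.finrank ℝ S : ℝ) : Measure S).map Subtype.val := by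
  rw [isometry_subtype_coe.map_hausdorffMeasure (Or.inl (Nat.cast_nonneg _)),
    Subtype.range_coe_subtype]
  rfl

theorem measurable_coe_linearEquiv_submodule {F : Type*} [NormedAddCommGroup F] [NormedSpace ℝ F]
    [FiniteDimensional ℝ F] [MeasurableSpace F] [BorelSpace F] (S : Submodule ℝ E) (φ : F ≃ₗ[ℝ] S) :
    Measurable fun x => (φ x : E) :=
  measurable_subtype_coe.comp φ.toContinuousLinearEquiv.continuous.measurable

/-- Hausdorff measure in the dimension of S and the image of ν are both Haar measures on S. So any
linear parametrisation may be used in place of an isometric one. -/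
theorem exists_hausdorffMeasure_restrict_submodule_eq_smul_map [FiniteDimensional ℝ E]
    {F : Type*} [NormedAddCommGroup F] [NormedSpace ℝ F] [FiniteDimensional ℝ F] [MeasurableSpace F] [BorelSpace F] (ν : Measure F)
    [ν.IsAddHaarMeasure] (S : Submodule ℝ E) (φ : F ≃ₗ[ℝ] S) : ∃ c : ℝ≥0∞, c ≠ 0 ∧ c ≠ ∞ ∧
    (Measure.hausdorffMeasure (Module.finrank ℝ S : ℝ)).restrict (S : Set E) =
      c • ν.map fun x => (φ x : E) := by
  have hm : Measurable φ := φ.toContinuousLinearEquiv.continuous.measurable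
  have : (ν.map φ).IsAddHaarMeasure := φ.toContinuousLinearEquiv.isAddHaarMeasure_map ν
  obtain ⟨c, hc0, hc, h⟩ := exists_eq_smul_of_isAddHaarMeasure
    (Measure.hausdorffMeasure (Module.finrank ℝ S : ℝ) : Measure S) (ν.map φ)
  refine ⟨c, hc0, hc, ?_⟩
  rw [hausdorffMeasure_restrict_submodule_eq_map, h, Measure.map_smul,
    Measure.map_map measurable_subtype_coe hm]
  rfl

theorem ae_hausdorffMeasure_restrict_submodule_notMem [FiniteDimensional ℝ E]
    {S T : Submodule ℝ E} (h : ¬ S ≤ T) :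
    ∀ᵐ x ∂(Measure.hausdorffMeasure (Module.finrank ℝ S : ℝ)).restrict (S : Set E), x ∉ T := by
  have hT : MeasurableSet {x : E | x ∉ T} :=
    (Submodule.closed_of_finiteDimensional T).measurableSet.compl
  rw [hausdorffMeasure_restrict_submodule_eq_map,
    ae_map_iff measurable_subtype_coe.aemeasurable hT]
  have hs : T.comap S.subtype ≠ ⊤ := fun h1 => h fun x hx =>
    (h1 ▸ Submodule.mem_top : (⟨x, hx⟩ : S) ∈ T.comap S.subtype)
  exact measure_eq_zero_iff_ae_notMem.1 (Measure.addHaar_submodule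
    (Measure.hausdorffMeasure (Module.finrank ℝ S : ℝ) : Measure S) _ hs)

end Submodule

/-- The Hausdorff measure of the space of closed polygons. -/
noncomputable def closedHausdorff (n : ℕ) : Measure (Arm n) :=
  (Measure.hausdorffMeasure (Module.finrank ℝ (closedPolygons n) : ℝ)).restrict
    (closedPolygons n : Set (Arm n))

theorem exists_closedHausdorff_eq_smul_map {m : ℕ} (i : Fin (m + 1)) : ∃ c : ℝ≥0∞, c ≠ 0 ∧ c ≠ ∞ ∧
    closedHausdorff (m + 1) = c • (volume : Measure (Fin m → EuclideanSpace ℝ (Fin 3))).map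
      fun x => (closedPolygonsEquiv i x : Arm (m + 1)) :=
  exists_hausdorffMeasure_restrict_submodule_eq_smul_map volume _ (closedPolygonsEquiv i)

theorem ae_closedHausdorff_ne_zero {n : ℕ} (hn : 2 ≤ n) :
    ∀ᵐ e ∂closedHausdorff n, ∀ i, e i ≠ 0 := by
  rw [ae_all_iff]
  intro i
  refine ae_hausdorffMeasure_restrict_submodule_notMem (S := closedPolygons n)
    (T := LinearMap.ker
      (PiLp.proj (𝕜 := ℝ) 2 (fun _ : Fin n => EuclideanSpace ℝ (Fin 3)) i).toLinearMap) fun h => ?_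
  obtain ⟨m, rfl⟩ : ∃ m, n = m + 2 := ⟨n - 2, by omega⟩
  -- A closed polygon whose i-th edge is minus a unit vector, so the condition e i = 0 cuts out a
  -- proper subspace.
  have h1 := LinearMap.mem_ker.1 (h (closedPolygonsEquiv i
    fun j => if j = 0 then EuclideanSpace.single 0 1 else 0).2)
  have h3 := congrArg (fun x : EuclideanSpace ℝ (Fin 3) => x 0) h1
  simp at h3

/-- The subspace measure of closed polygons before normalisation. -/
noncomputable def hopfGaussianClosedAux (n : ℕ) : Measure (Arm n) :=
  (closedHausdorff n).withDensity (pointDensity (hopfGaussianArm n))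

theorem hopfGaussianClosed_eq (n : ℕ) :
    hopfGaussianClosed n = (hopfGaussianClosedAux n Set.univ)⁻¹ • hopfGaussianClosedAux n := rfl

/-- The closed polygons are null for Lebesgue measure on arms when n is positive, so the density
must be identified pointwise. It is continuous where no edge vanishes, which is almost every closed
polygon. -/
theorem exists_hopfGaussianClosedAux_eq {n : ℕ} (hn : 2 ≤ n) : ∃ C : ℝ≥0∞, C ≠ 0 ∧ C ≠ ∞ ∧
    hopfGaussianClosedAux n =
      (closedHausdorff n).withDensity fun e => C * ∏ i, hopfDensity (e i) := by
  obtain ⟨C, hC0, hC, h⟩ := exists_hopfGaussianArm_eq_withDensity n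
  refine ⟨C, hC0, hC, withDensity_congr_ae ?_⟩
  filter_upwards [ae_closedHausdorff_ne_zero hn] with e he
  rw [h]
  exact pointDensity_withDensity
    (ENNReal.Tendsto.const_mul (continuousAt_prod_hopfDensity he) (.inr hC))

/-- Parametrise by the k+1 edges other than e i. Their densities assemble into the law of their sum
y = -e i, and the dependent edge contributes the extra, even, factor `hopfDensity y`. -/
theorem exists_lintegral_edge_hopfGaussianClosedAux {k : ℕ} (i : Fin (k + 2)) :
    ∃ C : ℝ≥0∞, C ≠ 0 ∧ C ≠ ∞ ∧ ∀ g : EuclideanSpace ℝ (Fin 3) → ℝ≥0∞, Measurable g →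
      ∫⁻ e, g (-e i) ∂hopfGaussianClosedAux (k + 2) =
        C * ∫⁻ y, g y * hopfDensity y ∂hopfProfileMeasure k := by
  obtain ⟨C₁, h₁, h₁', H₁⟩ := exists_hopfGaussianClosedAux_eq (n := k + 2) (by omega)
  obtain ⟨C₂, h₂, h₂', H₂⟩ := exists_closedHausdorff_eq_smul_map i
  obtain ⟨C₃, h₃, h₃', H₃⟩ := exists_map_sum_pi_hopfLaw_eq_smul k
  obtain ⟨a, ha, ha', Ha⟩ := exists_hopfLaw_eq_smul
  have hE : Measurable fun x => (closedPolygonsEquiv i x : Arm (k + 2)) :=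
    measurable_coe_linearEquiv_submodule _ _
  have hlaw : hopfLaw = volume.withDensity fun x => a * hopfDensity x := by
    rw [Ha, hopfProfileMeasure_zero, ← withDensity_smul _ measurable_hopfDensity]
    rfl
  have : SigmaFinite (volume.withDensity fun x => a * hopfDensity x) := by
    rw [← hlaw]; infer_instance
  have ha1 : a ^ (k + 1) ≠ 0 := pow_ne_zero _ ha
  have ha2 : a ^ (k + 1) ≠ ∞ := ENNReal.pow_ne_top ha'
  refine ⟨C₁ * C₂ * (a ^ (k + 1))⁻¹ * C₃, by simp [h₁, h₂, h₃, ha2], by finiteness, fun g hg => ?_⟩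
  have hsum : ∫⁻ x, g (∑ j, x j) * hopfDensity (∑ j, x j)
      ∂(Measure.pi fun _ : Fin (k + 1) => hopfLaw) =
      C₃ * ∫⁻ y, g y * hopfDensity y ∂hopfProfileMeasure k := by
    rw [← smul_eq_mul, ← lintegral_smul_measure, ← H₃, lintegral_map (by fun_prop) (by fun_prop)]
  have hsum' : ∫⁻ x, g (∑ j, x j) * hopfDensity (∑ j, x j)
      ∂(Measure.pi fun _ : Fin (k + 1) => hopfLaw) =
      a ^ (k + 1) * ∫⁻ x : Fin (k + 1) → EuclideanSpace ℝ (Fin 3), (∏ j, hopfDensity (x j)) *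
        (g (∑ j, x j) * hopfDensity (∑ j, x j)) := by
    rw [hlaw, pi_withDensity _ (by fun_prop),
      lintegral_withDensity_eq_lintegral_mul _ (by fun_prop) (by fun_prop),
      ← lintegral_const_mul _ (by fun_prop)]
    simp only [Pi.mul_apply, Finset.prod_mul_distrib, Finset.prod_const, Finset.card_univ,
      Fintype.card_fin, mul_assoc]
    rfl
  have hneg : ∀ y, hopfDensity (-y) = hopfDensity y := fun y => by simp [hopfDensity]
  have key : ∫⁻ e, g (-e i) ∂hopfGaussianClosedAux (k + 2) = C₁ * (C₂ *
      ∫⁻ x : Fin (k + 1) → EuclideanSpace ℝ (Fin 3), (∏ j, hopfDensity (x j)) *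
        (g (∑ j, x j) * hopfDensity (∑ j, x j))) := by
    rw [H₁, lintegral_withDensity_eq_lintegral_mul _ (by fun_prop) (by fun_prop)]
    simp only [Pi.mul_apply, mul_assoc]
    rw [lintegral_const_mul _ (by fun_prop), H₂, lintegral_smul_measure, smul_eq_mul,
      lintegral_map (by fun_prop) hE]
    congr 2
    refine lintegral_congr fun x => ?_
    rw [Fin.prod_univ_succAbove _ i]
    simp only [closedPolygonsEquiv_apply_same, closedPolygonsEquiv_apply_succAbove, neg_neg, hneg]
    ring
  rw [key, mul_assoc _ C₃, ← hsum, hsum', mul_assoc _ (a ^ (k + 1))⁻¹, ← mul_assoc (a ^ (k + 1))⁻¹,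
    ENNReal.inv_mul_cancel ha1 ha2, one_mul, mul_assoc]

/-! ### Moments of an edge -/

theorem lintegral_Ioo_rpow_mul_one_sub_pow {a : ℝ} (ha : 0 < a) (j : ℕ) :
    ∫⁻ u in Set.Ioo (0 : ℝ) 1, ENNReal.ofReal (u ^ (a - 1) * (1 - u) ^ j) =
      ENNReal.ofReal (beta a (j + 1)) := by
  have hb : 0 < beta a (j + 1) := beta_pos ha (by positivity)
  have h := lintegral_betaPDF_eq_one ha (by positivity : (0 : ℝ) < j + 1)
  rw [lintegral_betaPDF] at h
  rw [← mul_one (ENNReal.ofReal (beta a (j + 1))), ← h, ← lintegral_const_mul _ (by fun_prop)]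
  refine setLIntegral_congr_fun measurableSet_Ioo fun u _ => ?_
  rw [← ENNReal.ofReal_mul hb.le, add_sub_cancel_right, Real.rpow_natCast]
  congr 1
  field_simp

theorem lintegral_comp_const_mul {a : ℝ} (ha : 0 < a) {g : ℝ → ℝ≥0∞} (hg : Measurable g) :
    ∫⁻ r, g r = ENNReal.ofReal a * ∫⁻ u, g (a * u) := by
  rw [← lintegral_map (f := g) (g := fun u => a * u) hg (by fun_prop),
    Real.map_volume_mul_left ha.ne', lintegral_smul_measure, smul_eq_mul, ← mul_assoc,
    ← ENNReal.ofReal_mul ha.le, abs_of_pos (inv_pos.2 ha), mul_inv_cancel₀ ha.ne']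
  simp

theorem lintegral_Ioo_rpow_mul_sub_pow {a s : ℝ} (ha : 0 < a) (hs : 0 < s) (j : ℕ) :
    ∫⁻ r in Set.Ioo 0 (s / 2), ENNReal.ofReal (r ^ (a - 1) * (s - 2 * r) ^ j) =
      ENNReal.ofReal ((s / 2) ^ a * s ^ j * beta a (j + 1)) := by
  have hs2 : 0 < s / 2 := by positivity
  rw [← lintegral_indicator measurableSet_Ioo, lintegral_comp_const_mul hs2
    (Measurable.indicator (by fun_prop) measurableSet_Ioo)]
  have h : ∀ u, (Set.Ioo 0 (s / 2)).indicator
      (fun r => ENNReal.ofReal (r ^ (a - 1) * (s - 2 * r) ^ j)) (s / 2 * u) =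
      (Set.Ioo 0 1).indicator (fun u => ENNReal.ofReal ((s / 2) ^ (a - 1) * s ^ j) *
        ENNReal.ofReal (u ^ (a - 1) * (1 - u) ^ j)) u := by
    intro u
    have hiff : s / 2 * u ∈ Set.Ioo 0 (s / 2) ↔ u ∈ Set.Ioo (0 : ℝ) 1 := by
      simp only [Set.mem_Ioo, mul_pos_iff_of_pos_left hs2, mul_lt_iff_lt_one_right hs2]
    by_cases hu : u ∈ Set.Ioo (0 : ℝ) 1
    · rw [Set.indicator_of_mem hu, Set.indicator_of_mem (hiff.2 hu),
        ← ENNReal.ofReal_mul (by positivity), Real.mul_rpow hs2.le hu.1.le]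
      congr 1
      rw [show s - 2 * (s / 2 * u) = s * (1 - u) by ring, mul_pow]
      ring
    · rw [Set.indicator_of_notMem hu, Set.indicator_of_notMem (mt hiff.1 hu)]
  simp only [h]
  rw [lintegral_indicator measurableSet_Ioo, lintegral_const_mul _ (by fun_prop),
    lintegral_Ioo_rpow_mul_one_sub_pow ha, ← ENNReal.ofReal_mul (by positivity),
    ← ENNReal.ofReal_mul hs2.le]
  congr 1
  rw [Real.rpow_sub_one hs2.ne']
  field_simp

theorem lintegral_rpow_mul_exp_neg_half {q : ℝ} (hq : 0 < q) :
    ∫⁻ s in Set.Ioi (0 : ℝ), ENNReal.ofReal (s ^ (q - 1) * Real.exp (-s / 2)) =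
      ENNReal.ofReal (2 ^ q * Real.Gamma q) := by
  have h := Real.integral_rpow_mul_exp_neg_mul_Ioi hq (r := 1 / 2) (by norm_num)
  have hint : IntegrableOn (fun s : ℝ => s ^ (q - 1) * Real.exp (-s / 2)) (Set.Ioi 0) := by
    have := integrableOn_rpow_mul_exp_neg_mul_rpow (s := q - 1) (p := 1) (b := 1 / 2)
      (by linarith) zero_lt_one (by norm_num)
    refine this.congr_fun (fun s _ => ?_) measurableSet_Ioi
    simp only [Real.rpow_one]
    congr 2
    ring
  rw [← ofReal_integral_eq_lintegral_ofReal hint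
    ((ae_restrict_mem measurableSet_Ioi).mono fun s (hs : 0 < s) => by positivity)]
  congr 1
  rw [one_div_one_div] at h
  rw [← h]
  congr 1
  ext s
  congr 2
  ring

theorem lintegral_Ioi_comp_add_left (r a : ℝ) (g : ℝ → ℝ≥0∞) :
    ∫⁻ t in Set.Ioi a, g t = ∫⁻ s in Set.Ioi (r + a), g (s - r) := by
  rw [← lintegral_Ioi_add r a fun s => g (s - r)]
  simp

/-- Put t = s - r in the profile. Then t² - r² = s(s-2r), and the two exponentials merge into
exp(-s/2). After exchanging integrals, r runs over (0, s/2) and gives a beta value times a power of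
s, whose s-integral is a gamma value. The bound p > -2 is integrability at r = 0. -/
theorem lintegral_rpow_mul_hopfProfile {p : ℝ} (hp : -2 < p) (j : ℕ) :
    ∫⁻ r in Set.Ioi (0 : ℝ), ENNReal.ofReal (r ^ (p + 1) * Real.exp (-r / 2)) *
      hopfProfile (j + 1) (r ^ 2) =
    ENNReal.ofReal (2 ^ (2 * j + 1 : ℝ) * Real.Gamma (p + 2 * j + 3) * beta (p + 2) (j + 1)) := by
  have hp2 : 0 < p + 2 := by linarith
  have hB : 0 < beta (p + 2) (j + 1) := beta_pos hp2 (by positivity)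
  have h1 : ∀ r ∈ Set.Ioi (0 : ℝ), ENNReal.ofReal (r ^ (p + 1) * Real.exp (-r / 2)) *
      hopfProfile (j + 1) (r ^ 2) = ∫⁻ s, {x : ℝ × ℝ | 2 * x.1 < x.2}.indicator (fun x =>
        ENNReal.ofReal (x.2 ^ j * Real.exp (-x.2 / 2)) *
        ENNReal.ofReal (x.1 ^ (p + 1) * (x.2 - 2 * x.1) ^ j)) (r, s) := by
    intro r hr
    have hr0 : 0 < r := hr
    have h2 : ∀ s, {x : ℝ × ℝ | 2 * x.1 < x.2}.indicator (fun x =>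
        ENNReal.ofReal (x.2 ^ j * Real.exp (-x.2 / 2)) *
        ENNReal.ofReal (x.1 ^ (p + 1) * (x.2 - 2 * x.1) ^ j)) (r, s) =
        (Set.Ioi (r + r)).indicator (fun s => ENNReal.ofReal (s ^ j * Real.exp (-s / 2)) *
        ENNReal.ofReal (r ^ (p + 1) * (s - 2 * r) ^ j)) s := by
      intro s
      simp only [Set.indicator, Set.mem_ofPred_eq, Set.mem_Ioi, two_mul]
    simp only [h2]
    rw [lintegral_indicator measurableSet_Ioi, hopfProfile, Real.sqrt_sq hr0.le,
      lintegral_Ioi_comp_add_left r r, ← lintegral_const_mul _ (by fun_prop)]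
    refine setLIntegral_congr_fun measurableSet_Ioi fun s hs => ?_
    have hs0 : r + r < s := hs
    have hs1 : 0 < s := by linarith
    rw [← ENNReal.ofReal_mul (by positivity), ← ENNReal.ofReal_mul (by positivity)]
    congr 1
    rw [show (s - r) ^ 2 - r ^ 2 = s * (s - 2 * r) by ring, mul_pow,
      show -s / 2 = -r / 2 + -(s - r) / 2 by ring, Real.exp_add]
    ring
  have hmeas : Measurable ({x : ℝ × ℝ | 2 * x.1 < x.2}.indicator (fun x =>
        ENNReal.ofReal (x.2 ^ j * Real.exp (-x.2 / 2)) *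
        ENNReal.ofReal (x.1 ^ (p + 1) * (x.2 - 2 * x.1) ^ j))) :=
    Measurable.indicator (by fun_prop) (measurableSet_lt (by fun_prop) (by fun_prop))
  rw [setLIntegral_congr_fun measurableSet_Ioi h1, lintegral_lintegral_swap
    (f := fun r s => {x : ℝ × ℝ | 2 * x.1 < x.2}.indicator (fun x =>
        ENNReal.ofReal (x.2 ^ j * Real.exp (-x.2 / 2)) *
        ENNReal.ofReal (x.1 ^ (p + 1) * (x.2 - 2 * x.1) ^ j)) (r, s)) hmeas.aemeasurable]
  have h3 : ∀ s, ∫⁻ r in Set.Ioi (0 : ℝ), {x : ℝ × ℝ | 2 * x.1 < x.2}.indicator (fun x =>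
        ENNReal.ofReal (x.2 ^ j * Real.exp (-x.2 / 2)) *
        ENNReal.ofReal (x.1 ^ (p + 1) * (x.2 - 2 * x.1) ^ j)) (r, s) =
      (Set.Ioi 0).indicator (fun s => ENNReal.ofReal (2⁻¹ ^ (p + 2) * beta (p + 2) (j + 1)) *
        ENNReal.ofReal (s ^ (p + 2 * j + 3 - 1) * Real.exp (-s / 2))) s := by
    intro s
    have h4 : ∀ r, (Set.Ioi (0 : ℝ)).indicator (fun r => {x : ℝ × ℝ | 2 * x.1 < x.2}.indicator
        (fun x => ENNReal.ofReal (x.2 ^ j * Real.exp (-x.2 / 2)) *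
        ENNReal.ofReal (x.1 ^ (p + 1) * (x.2 - 2 * x.1) ^ j)) (r, s)) r =
        (Set.Ioo 0 (s / 2)).indicator (fun r => ENNReal.ofReal (s ^ j * Real.exp (-s / 2)) *
        ENNReal.ofReal (r ^ (p + 1) * (s - 2 * r) ^ j)) r := by
      intro r
      have : r < s / 2 ↔ 2 * r < s := by rw [lt_div_iff₀ two_pos, mul_comm]
      simp only [Set.indicator, Set.mem_ofPred_eq, Set.mem_Ioi, Set.mem_Ioo, this, ite_and]
    rw [← lintegral_indicator measurableSet_Ioi]
    simp only [h4]
    rw [lintegral_indicator measurableSet_Ioo]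
    by_cases hs : s ∈ Set.Ioi (0 : ℝ)
    · have hs0 : 0 < s := hs
      rw [Set.indicator_of_mem hs, lintegral_const_mul _ (by fun_prop),
        show p + 1 = p + 2 - 1 by ring, lintegral_Ioo_rpow_mul_sub_pow hp2 hs0,
        ← ENNReal.ofReal_mul (by positivity), ← ENNReal.ofReal_mul (by positivity)]
      congr 1
      have h5 : s ^ (p + 2 * j + 3 - 1) = s ^ (p + 2) * s ^ j * s ^ j := by
        rw [show p + 2 * (j : ℝ) + 3 - 1 = (p + 2) + j + j by ring, Real.rpow_add hs0,
          Real.rpow_add hs0, Real.rpow_natCast]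
      rw [h5, Real.div_rpow hs0.le two_pos.le, Real.inv_rpow two_pos.le]
      ring
    · rw [Set.indicator_of_notMem hs, Set.Ioo_eq_empty fun h => hs (by
        rw [Set.mem_Ioi]; linarith)]
      simp
  simp only [h3]
  rw [lintegral_indicator measurableSet_Ioi, lintegral_const_mul _ (by fun_prop),
    lintegral_rpow_mul_exp_neg_half (by have : (0 : ℝ) ≤ j := j.cast_nonneg; linarith),
    ← ENNReal.ofReal_mul (by positivity)]
  congr 1
  rw [show p + 2 * (j : ℝ) + 3 = (p + 2) + (2 * j + 1) by ring, Real.rpow_add two_pos,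
    Real.inv_rpow two_pos.le]
  have : (2 : ℝ) ^ (p + 2) ≠ 0 := by positivity
  field_simp

/-- The unnormalised `p`-th moment of an edge of a random closed `(j + 3)`-gon. -/
noncomputable def edgeMomentWeight (j : ℕ) (p : ℝ) : ℝ :=
  2 ^ (2 * j + 1 : ℝ) * Real.Gamma (p + 2 * j + 3) * beta (p + 2) (j + 1)

theorem edgeMomentWeight_pos (j : ℕ) {p : ℝ} (hp : -2 < p) : 0 < edgeMomentWeight j p := by
  have hj : (0 : ℝ) ≤ j := j.cast_nonneg
  have h1 : 0 < Real.Gamma (p + 2 * j + 3) := Real.Gamma_pos_of_pos (by linarith)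
  have h2 : 0 < beta (p + 2) (j + 1) := beta_pos (by linarith) (by positivity)
  unfold edgeMomentWeight
  positivity

theorem exists_lintegral_norm_edge_rpow_aux (j : ℕ) (i : Fin (j + 3)) : ∃ K : ℝ≥0∞, K ≠ 0 ∧ K ≠ ∞ ∧
    ∀ p : ℝ, -2 < p → ∫⁻ e, ENNReal.ofReal (‖e i‖ ^ p) ∂hopfGaussianClosedAux (j + 3) =
      K * ENNReal.ofReal (edgeMomentWeight j p) := by
  obtain ⟨C, hC0, hC, h⟩ := exists_lintegral_edge_hopfGaussianClosedAux (k := j + 1) i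
  obtain ⟨c, hc⟩ : ∃ c : ℝ≥0∞, c = Module.finrank ℝ (EuclideanSpace ℝ (Fin 3)) *
    volume (Metric.ball (0 : EuclideanSpace ℝ (Fin 3)) 1) := ⟨_, rfl⟩
  have hc0 : c ≠ 0 := by
    rw [hc]
    refine mul_ne_zero (by simp) (Metric.measure_ball_pos _ _ one_pos).ne'
  have hct : c ≠ ∞ := hc ▸ ENNReal.mul_ne_top (by simp) measure_ball_lt_top.ne
  refine ⟨C * c, mul_ne_zero hC0 hc0, ENNReal.mul_ne_top hC hct, fun p hp => ?_⟩
  have h1 := h (fun y => ENNReal.ofReal (‖y‖ ^ p)) (by fun_prop)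
  simp only [norm_neg] at h1
  rw [h1, mul_assoc, hopfProfileMeasure, lintegral_withDensity_eq_lintegral_mul _ (by fun_prop)
    (by fun_prop)]
  congr 1
  have h2 := lintegral_fun_norm_addHaar (volume : Measure (EuclideanSpace ℝ (Fin 3)))
    (g := fun r => hopfProfile (j + 1) (r ^ 2) *
      (ENNReal.ofReal (r ^ p) * ENNReal.ofReal (Real.exp (-r / 2) / r))) (by fun_prop)
  rw [← hc] at h2
  refine h2.trans ?_
  rw [edgeMomentWeight, ← lintegral_rpow_mul_hopfProfile hp]
  congr 1
  refine setLIntegral_congr_fun measurableSet_Ioi fun r hr => ?_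
  have hr0 : 0 < r := hr
  rw [← ENNReal.ofReal_mul (by positivity), mul_left_comm, ← ENNReal.ofReal_mul (by positivity),
    mul_comm]
  congr 2
  -- The Jacobian r² against the factor 1/r of the edge density leaves r^(p+1).
  rw [finrank_euclideanSpace_fin, Real.rpow_add_one hr0.ne']
  field_simp

theorem hopfGaussianClosedAux_univ_ne (j : ℕ) :
    hopfGaussianClosedAux (j + 3) Set.univ ≠ 0 ∧ hopfGaussianClosedAux (j + 3) Set.univ ≠ ∞ := by
  obtain ⟨K, hK0, hK, h⟩ := exists_lintegral_norm_edge_rpow_aux j 0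
  -- The zeroth moment is the total mass.
  have h0 := h 0 (by norm_num)
  simp only [Real.rpow_zero, ENNReal.ofReal_one, lintegral_one] at h0
  rw [h0]
  have := edgeMomentWeight_pos j (p := 0) (by norm_num)
  exact ⟨mul_ne_zero hK0 (by simpa), ENNReal.mul_ne_top hK ENNReal.ofReal_ne_top⟩

instance isProbabilityMeasure_hopfGaussianClosed (j : ℕ) :
    IsProbabilityMeasure (hopfGaussianClosed (j + 3)) := by
  obtain ⟨h0, h⟩ := hopfGaussianClosedAux_univ_ne j
  refine ⟨?_⟩
  rw [hopfGaussianClosed_eq, Measure.smul_apply, smul_eq_mul, ENNReal.inv_mul_cancel h0 h]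

theorem measurableSet_closedPolygons (n : ℕ) :
    MeasurableSet (closedPolygons n : Set (Arm n)) :=
  (isClosed_eq (by fun_prop) continuous_const :
    IsClosed {e : Arm n | ∑ i, e i = 0}).measurableSet

theorem ae_mem_closedPolygons (n : ℕ) : ∀ᵐ e ∂hopfGaussianClosed n, e ∈ closedPolygons n := by
  rw [hopfGaussianClosed_eq]
  refine Measure.ae_smul_measure ?_ _
  refine (withDensity_absolutelyContinuous _ _).ae_le ?_
  exact ae_restrict_mem (measurableSet_closedPolygons n)

theorem lintegral_norm_edge_rpow (j : ℕ) (i : Fin (j + 3)) {p : ℝ} (hp : -2 < p) :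
    ∫⁻ e, ENNReal.ofReal (‖e i‖ ^ p) ∂hopfGaussianClosed (j + 3) =
      ENNReal.ofReal (edgeMomentWeight j p / edgeMomentWeight j 0) := by
  obtain ⟨K, hK0, hK, h⟩ := exists_lintegral_norm_edge_rpow_aux j i
  have h0 := h 0 (by norm_num)
  simp only [Real.rpow_zero, ENNReal.ofReal_one, lintegral_one] at h0
  have hw := edgeMomentWeight_pos j (p := 0) (by norm_num)
  rw [hopfGaussianClosed_eq, lintegral_smul_measure, h p hp, h0, smul_eq_mul, mul_comm,
    ← div_eq_mul_inv, ENNReal.mul_div_mul_left _ _ hK0 hK, ENNReal.ofReal_div_of_pos hw]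

theorem edgeMomentWeight_div (j : ℕ) (p : ℝ) :
    edgeMomentWeight j p / edgeMomentWeight j 0 =
      (j + 2) * Real.Gamma (p + 2 * j + 3) / (2 * Real.Gamma (2 * j + 2)) * beta (p + 2) (j + 1) := by
  have hj : (0 : ℝ) ≤ j := j.cast_nonneg
  have h1 : Real.Gamma (0 + 2 * j + 3) = (2 * j + 2) * Real.Gamma (2 * j + 2) := by
    rw [← Real.Gamma_add_one (by positivity)]
    ring_nf
  have h2 : beta (0 + 2) (j + 1) = 1 / ((j + 2) * (j + 1)) := by
    have h3 : Real.Gamma (0 + 2 + (j + 1)) = (j + 2) * ((j + 1) * Real.Gamma (j + 1)) := by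
      rw [← Real.Gamma_add_one (by positivity), show (0 : ℝ) + 2 + (j + 1) = j + 2 + 1 by ring,
        Real.Gamma_add_one (by positivity)]
      ring_nf
    have h4 : Real.Gamma (j + 1) ≠ 0 := (Real.Gamma_pos_of_pos (by positivity)).ne'
    rw [beta, h3, zero_add, Real.Gamma_two]
    field_simp
  have h5 : Real.Gamma (2 * j + 2) ≠ 0 := (Real.Gamma_pos_of_pos (by positivity)).ne'
  have h6 : (2 : ℝ) ^ (2 * j + 1 : ℝ) ≠ 0 := by positivity
  rw [edgeMomentWeight, edgeMomentWeight, h1, h2]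
  field_simp

theorem integrable_norm_edge_rpow (j : ℕ) (i : Fin (j + 3)) {p : ℝ} (hp : -2 < p) :
    Integrable (fun e : Arm (j + 3) => ‖e i‖ ^ p) (hopfGaussianClosed (j + 3)) := by
  refine ⟨Measurable.aestronglyMeasurable (by fun_prop), ?_⟩
  rw [hasFiniteIntegral_iff_ofReal (Eventually.of_forall fun e => by positivity),
    lintegral_norm_edge_rpow j i hp]
  exact ENNReal.ofReal_lt_top

theorem integral_norm_edge_rpow (j : ℕ) (i : Fin (j + 3)) {p : ℝ} (hp : -2 < p) :
    ∫ e, ‖e i‖ ^ p ∂hopfGaussianClosed (j + 3) =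
      (j + 2) * Real.Gamma (p + 2 * j + 3) / (2 * Real.Gamma (2 * j + 2)) * beta (p + 2) (j + 1) := by
  rw [integral_eq_lintegral_of_nonneg_ae (Eventually.of_forall fun e => by positivity)
    (Measurable.aestronglyMeasurable (by fun_prop)), lintegral_norm_edge_rpow j i hp,
    ENNReal.toReal_ofReal
    (div_pos (edgeMomentWeight_pos j hp) (edgeMomentWeight_pos j (by norm_num))).le,
    edgeMomentWeight_div]

theorem integrable_norm_edge_sq (j : ℕ) (i : Fin (j + 3)) :
    Integrable (fun e : Arm (j + 3) => ‖e i‖ ^ 2) (hopfGaussianClosed (j + 3)) := by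
  simpa using integrable_norm_edge_rpow j i (p := 2) (by norm_num)

theorem integral_norm_edge_sq (j : ℕ) (i : Fin (j + 3)) :
    ∫ e, ‖e i‖ ^ 2 ∂hopfGaussianClosed (j + 3) =
      12 * (j + 2) * (2 * j + 3) / ((j + 3) * (j + 4)) := by
  have h := integral_norm_edge_rpow j i (p := 2) (by norm_num)
  simp only [Real.rpow_ofNat] at h
  have hj : (0 : ℝ) ≤ j := j.cast_nonneg
  have h1 : Real.Gamma (2 + 2 * j + 3) =
      (2 * j + 4) * ((2 * j + 3) * ((2 * j + 2) * Real.Gamma (2 * j + 2))) := by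
    rw [show (2 : ℝ) + 2 * j + 3 = 2 * j + 2 + 1 + 1 + 1 by ring,
      Real.Gamma_add_one (by positivity), Real.Gamma_add_one (by positivity),
      Real.Gamma_add_one (by positivity)]
    ring
  have h2 : Real.Gamma (2 + 2 + (j + 1)) =
      (j + 4) * ((j + 3) * ((j + 2) * ((j + 1) * Real.Gamma (j + 1)))) := by
    rw [show (2 : ℝ) + 2 + (j + 1) = j + 1 + 1 + 1 + 1 + 1 by ring,
      Real.Gamma_add_one (by positivity), Real.Gamma_add_one (by positivity),
      Real.Gamma_add_one (by positivity), Real.Gamma_add_one (by positivity)]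
    ring
  have h3 : Real.Gamma (2 + 2) = 6 := by
    rw [show (2 : ℝ) + 2 = 2 + 1 + 1 by norm_num, Real.Gamma_add_one (by norm_num),
      Real.Gamma_add_one (by norm_num), Real.Gamma_two]
    norm_num
  have h4 : Real.Gamma (j + 1) ≠ 0 := (Real.Gamma_pos_of_pos (by positivity)).ne'
  have h5 : Real.Gamma (2 * j + 2) ≠ 0 := (Real.Gamma_pos_of_pos (by positivity)).ne'
  rw [h, beta, h1, h2, h3]
  field_simp
  ring

/-! ### Exchangeability, correlations of edges and chords -/

/-- The relabelling of the edges of an arm. -/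
noncomputable def armPerm {n : ℕ} (σ : Equiv.Perm (Fin n)) : Arm n ≃ₗᵢ[ℝ] Arm n :=
  LinearIsometryEquiv.piLpCongrLeft 2 ℝ (EuclideanSpace ℝ (Fin 3)) σ

theorem armPerm_apply {n : ℕ} (σ : Equiv.Perm (Fin n)) (e : Arm n) (i : Fin n) :
    armPerm σ e i = e (σ.symm i) := by
  simp [armPerm, LinearIsometryEquiv.piLpCongrLeft_apply]

theorem measurePreserving_armPerm_closedHausdorff {n : ℕ} (σ : Equiv.Perm (Fin n)) :
    MeasurePreserving (armPerm σ) (closedHausdorff n) (closedHausdorff n) := by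
  have h := ((armPerm σ).toIsometryEquiv.measurePreserving_hausdorffMeasure
    (Module.finrank ℝ (closedPolygons n) : ℝ)).restrict_preimage
    (s := (closedPolygons n : Set (Arm n)))
    (measurableSet_closedPolygons n)
  have hpre : (armPerm σ).toIsometryEquiv ⁻¹' (closedPolygons n : Set (Arm n)) =
      (closedPolygons n : Set (Arm n)) := by
    ext e
    simp only [Set.mem_preimage, SetLike.mem_coe, mem_closedPolygons]
    change ∑ i, armPerm σ e i = 0 ↔ _
    simp only [armPerm_apply]
    rw [Equiv.sum_comp σ.symm fun i => e i]
  rw [hpre] at h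
  exact h

/-- A relabelling is an isometry that preserves closure, hence Hausdorff measure, and the density is
a symmetric product. -/
theorem map_armPerm_hopfGaussianClosed {n : ℕ} (hn : 2 ≤ n) (σ : Equiv.Perm (Fin n)) :
    (hopfGaussianClosed n).map (armPerm σ) = hopfGaussianClosed n := by
  obtain ⟨C, -, -, h⟩ := exists_hopfGaussianClosedAux_eq hn
  have hσ : Measurable (armPerm σ) := (armPerm σ).continuous.measurable
  rw [hopfGaussianClosed_eq, Measure.map_smul, h]
  congr 1
  refine Measure.ext_of_lintegral _ fun g hg => ?_
  have hgσ : Measurable fun e => g (armPerm σ e) := hg.comp hσ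
  rw [lintegral_map hg hσ, lintegral_withDensity_eq_lintegral_mul _ (by fun_prop) hgσ,
    lintegral_withDensity_eq_lintegral_mul _ (by fun_prop) hg,
    ← (measurePreserving_armPerm_closedHausdorff σ).lintegral_comp
      ((by fun_prop : Measurable fun e : Arm n => C * ∏ i, hopfDensity (e i)).mul hg)]
  refine lintegral_congr fun e => ?_
  simp only [Pi.mul_apply, armPerm_apply]
  rw [Equiv.prod_comp σ.symm fun i => hopfDensity (e i)]

theorem integral_comp_armPerm {n : ℕ} (hn : 2 ≤ n) (σ : Equiv.Perm (Fin n)) (g : Arm n → ℝ) :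
    ∫ e, g (armPerm σ e) ∂hopfGaussianClosed n = ∫ e, g e ∂hopfGaussianClosed n := by
  conv_rhs => rw [← map_armPerm_hopfGaussianClosed hn σ]
  exact ((armPerm σ).toHomeomorph.measurableEmbedding.integral_map g).symm

theorem integrable_inner_edge (j : ℕ) (a b : Fin (j + 3)) :
    Integrable (fun e : Arm (j + 3) => inner ℝ (e a) (e b)) (hopfGaussianClosed (j + 3)) := by
  refine ((integrable_norm_edge_sq j a).add (integrable_norm_edge_sq j b)).mono' (by fun_prop)
    (Eventually.of_forall fun e => ?_)
  simp only [Pi.add_apply, Real.norm_eq_abs]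
  refine (abs_real_inner_le_norm _ _).trans ?_
  nlinarith [sq_nonneg (‖e a‖ - ‖e b‖), sq_nonneg ‖e a‖, sq_nonneg ‖e b‖]

/-- All E⟨e_a, e_c⟩ with c ≠ a agree by exchangeability, and closure gives 0 = E⟨e_a, Σ e_c⟩ =
E|e_a|² + (n-1) E⟨e_a, e_b⟩, where n = j+3. -/
theorem integral_inner_edge_of_ne (j : ℕ) {a b : Fin (j + 3)} (hab : a ≠ b) :
    ∫ e, inner ℝ (e a) (e b) ∂hopfGaussianClosed (j + 3) =
      -(12 * (2 * j + 3) / ((j + 3) * (j + 4))) := by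
  have hswap : ∀ c ≠ a, ∫ e, inner ℝ (e a) (e c) ∂hopfGaussianClosed (j + 3) =
      ∫ e, inner ℝ (e a) (e b) ∂hopfGaussianClosed (j + 3) := by
    intro c hc
    rw [← integral_comp_armPerm (by omega) (Equiv.swap b c) fun e => inner ℝ (e a) (e b)]
    simp only [armPerm_apply, Equiv.symm_swap, Equiv.swap_apply_left,
      Equiv.swap_apply_of_ne_of_ne hab hc.symm]
  have hsum : ∑ c, ∫ e, inner ℝ (e a) (e c) ∂hopfGaussianClosed (j + 3) = 0 := by
    rw [← integral_finsetSum _ fun c _ => integrable_inner_edge j a c]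
    refine integral_eq_zero_of_ae ?_
    filter_upwards [ae_mem_closedPolygons (j + 3)] with e he
    rw [← inner_sum, mem_closedPolygons.1 he, inner_zero_right]
    rfl
  rw [← Finset.add_sum_erase _ _ (Finset.mem_univ a),
    Finset.sum_congr rfl fun c hc => hswap c (Finset.ne_of_mem_erase hc)] at hsum
  simp only [real_inner_self_eq_norm_sq, integral_norm_edge_sq, Finset.sum_const,
    Finset.card_erase_of_mem (Finset.mem_univ a), Finset.card_univ, Fintype.card_fin,
    nsmul_eq_mul] at hsum
  push_cast at hsum
  have hj : (0 : ℝ) < j + 2 := by positivity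
  refine mul_left_cancel₀ hj.ne' ?_
  rw [eq_neg_of_add_eq_zero_right hsum]
  ring

theorem norm_sum_edge_sq {n : ℕ} (s : Finset (Fin n)) (e : Arm n) :
    ‖∑ a ∈ s, e a‖ ^ 2 = ∑ a ∈ s, ∑ b ∈ s, inner ℝ (e a) (e b) := by
  rw [← real_inner_self_eq_norm_sq, sum_inner]
  simp only [inner_sum]

theorem integrable_norm_sum_edge_sq (j : ℕ) (s : Finset (Fin (j + 3))) :
    Integrable (fun e : Arm (j + 3) => ‖∑ a ∈ s, e a‖ ^ 2) (hopfGaussianClosed (j + 3)) := by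
  simp only [norm_sum_edge_sq]
  exact integrable_finsetSum _ fun a _ => integrable_finsetSum _ fun b _ =>
    integrable_inner_edge j a b

theorem integral_norm_sum_edge_sq (j : ℕ) (s : Finset (Fin (j + 3))) :
    ∫ e, ‖∑ a ∈ s, e a‖ ^ 2 ∂hopfGaussianClosed (j + 3) =
      s.card * (j + 3 - s.card) * (12 * (2 * j + 3) / ((j + 3) * (j + 4))) := by
  simp only [norm_sum_edge_sq]
  rw [integral_finsetSum _ fun a _ => integrable_finsetSum _ fun b _ =>
    integrable_inner_edge j a b]
  have h : ∀ a ∈ s, ∫ e, ∑ b ∈ s, inner ℝ (e a) (e b) ∂hopfGaussianClosed (j + 3) =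
      (j + 3 - s.card) * (12 * (2 * j + 3) / ((j + 3) * (j + 4))) := by
    intro a ha
    rw [integral_finsetSum _ fun b _ => integrable_inner_edge j a b,
      ← Finset.add_sum_erase _ _ ha, Finset.sum_congr rfl fun b hb =>
        integral_inner_edge_of_ne j (Finset.ne_of_mem_erase hb).symm]
    simp only [real_inner_self_eq_norm_sq, integral_norm_edge_sq, Finset.sum_const,
      nsmul_eq_mul, Finset.cast_card_erase_of_mem ha]
    ring
  rw [Finset.sum_congr rfl h, Finset.sum_const, nsmul_eq_mul, mul_assoc]

/-- At most n consecutive integers are distinct modulo n, so no edge of the chord repeats even when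
it wraps past the last vertex. -/
theorem exists_vertex_add_sub_eq_sum {n : ℕ} [NeZero n] (m : ℕ) {k : ℕ} (hk : k ≤ n) :
    ∃ s : Finset (Fin n), s.card = k ∧
      ∀ e : Arm n, vertex e (m + k) - vertex e m = ∑ a ∈ s, e a := by
  have hinj : Set.InjOn (fun j => Fin.ofNat n (m + j)) (Finset.range k) := by
    intro a ha b hb hab
    have h1 : (m + a) % n = (m + b) % n := congrArg Fin.val hab
    have h2 : a ≡ b [MOD n] := Nat.ModEq.add_left_cancel' m h1
    exact h2.eq_of_lt_of_lt ((Finset.mem_range.1 ha).trans_le hk)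
      ((Finset.mem_range.1 hb).trans_le hk)
  refine ⟨(Finset.range k).image fun j => Fin.ofNat n (m + j), ?_, fun e => ?_⟩
  · rw [Finset.card_image_of_injOn hinj, Finset.card_range]
  · rw [Finset.sum_image hinj, vertex, vertex, Finset.sum_range_add_sub_sum_range]

theorem integrable_norm_vertex_add_sub_sq (j m : ℕ) {k : ℕ} (hk : k ≤ j + 3) :
    Integrable (fun e : Arm (j + 3) => ‖vertex e (m + k) - vertex e m‖ ^ 2)
      (hopfGaussianClosed (j + 3)) := by
  obtain ⟨s, -, hs⟩ := exists_vertex_add_sub_eq_sum (n := j + 3) m hk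
  simp only [hs]
  exact integrable_norm_sum_edge_sq j s

theorem integral_norm_vertex_add_sub_sq (j m : ℕ) {k : ℕ} (hk : k ≤ j + 3) :
    ∫ e : Arm (j + 3), ‖vertex e (m + k) - vertex e m‖ ^ 2 ∂hopfGaussianClosed (j + 3) =
      k * (j + 3 - k) * (12 * (2 * j + 3) / ((j + 3) * (j + 4))) := by
  obtain ⟨s, hcard, hs⟩ := exists_vertex_add_sub_eq_sum (n := j + 3) m hk
  simp only [hs]
  rw [integral_norm_sum_edge_sq, hcard]

theorem norm_vertex_sub_vertex_sq {n : ℕ} [NeZero n] (e : Arm n) (a b : ℕ) :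
    ‖vertex e a - vertex e b‖ ^ 2 =
      ‖vertex e (min a b + (max a b - min a b)) - vertex e (min a b)‖ ^ 2 := by
  rw [Nat.add_sub_cancel' min_le_max]
  rcases le_total a b with h | h
  · rw [max_eq_right h, min_eq_left h, norm_sub_rev]
  · rw [max_eq_left h, min_eq_right h]

theorem integrable_norm_vertex_sub_vertex_sq (j : ℕ) (a b : Fin (j + 3)) :
    Integrable (fun e : Arm (j + 3) => ‖vertex e a - vertex e b‖ ^ 2)
      (hopfGaussianClosed (j + 3)) := by
  simp only [norm_vertex_sub_vertex_sq _ (a : ℕ) b]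
  exact integrable_norm_vertex_add_sub_sq j _ (by omega)

theorem integral_norm_vertex_sub_vertex_sq (j : ℕ) (a b : Fin (j + 3)) :
    ∫ e : Arm (j + 3), ‖vertex e a - vertex e b‖ ^ 2 ∂hopfGaussianClosed (j + 3) =
      ((j + 3) * |(a : ℝ) - b| - ((a : ℝ) - b) ^ 2) *
        (12 * (2 * j + 3) / ((j + 3) * (j + 4))) := by
  simp only [norm_vertex_sub_vertex_sq _ (a : ℕ) b]
  rw [integral_norm_vertex_add_sub_sq j _ (by omega)]
  have h : ((max (a : ℕ) b - min (a : ℕ) b : ℕ) : ℝ) = |(a : ℝ) - b| := by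
    rw [Nat.cast_sub min_le_max, Nat.cast_max, Nat.cast_min, max_sub_min_eq_abs', abs_sub_comm]
  rw [h, ← sq_abs]
  ring

/-! ### Averaging over chords: the radius of gyration -/

theorem sum_range_cast_sub (c : ℝ) (N : ℕ) :
    ∑ a ∈ Finset.range N, (c - a) = N * c - N * (N - 1) / 2 := by
  induction N with
  | zero => simp
  | succ N ih =>
    rw [Finset.sum_range_succ, ih]
    push_cast
    ring

theorem sum_range_cast_sub_sq (c : ℝ) (N : ℕ) :
    ∑ a ∈ Finset.range N, (c - a) ^ 2 =
      N * c ^ 2 - c * (N * (N - 1)) + N * (N - 1) * (2 * N - 1) / 6 := by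
  induction N with
  | zero => simp
  | succ N ih =>
    rw [Finset.sum_range_succ, ih]
    push_cast
    ring

theorem sum_range_sum_range_symm_succ (f : ℕ → ℕ → ℝ) (hf : ∀ a b, f a b = f b a)
    (hf0 : ∀ a, f a a = 0) (N : ℕ) :
    ∑ a ∈ Finset.range (N + 1), ∑ b ∈ Finset.range (N + 1), f a b =
      ∑ a ∈ Finset.range N, ∑ b ∈ Finset.range N, f a b + 2 * ∑ a ∈ Finset.range N, f N a := by
  simp only [Finset.sum_range_succ, Finset.sum_add_distrib, hf0, hf _ N]
  ring

theorem sum_range_sum_range_abs_sub (N : ℕ) :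
    ∑ a ∈ Finset.range N, ∑ b ∈ Finset.range N, |(a : ℝ) - b| = (N ^ 3 - N) / 3 := by
  induction N with
  | zero => simp
  | succ N ih =>
    have h : ∑ a ∈ Finset.range N, |(N : ℝ) - a| = N * N - N * (N - 1) / 2 := by
      rw [← sum_range_cast_sub]
      refine Finset.sum_congr rfl fun a ha => abs_of_nonneg ?_
      exact sub_nonneg.2 (by exact_mod_cast (Finset.mem_range.1 ha).le)
    rw [sum_range_sum_range_symm_succ (fun a b => |(a : ℝ) - b|) (fun a b => abs_sub_comm _ _)
      (by simp), ih, h]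
    push_cast
    ring

theorem sum_range_sum_range_sub_sq (N : ℕ) :
    ∑ a ∈ Finset.range N, ∑ b ∈ Finset.range N, ((a : ℝ) - b) ^ 2 = N ^ 2 * (N ^ 2 - 1) / 6 := by
  induction N with
  | zero => simp
  | succ N ih =>
    rw [sum_range_sum_range_symm_succ (fun a b => ((a : ℝ) - b) ^ 2) (fun a b => by ring)
      (by simp), ih, sum_range_cast_sub_sq]
    push_cast
    ring

theorem integrable_gyradiusSq (j : ℕ) :
    Integrable (fun e : Arm (j + 3) => gyradiusSq e) (hopfGaussianClosed (j + 3)) :=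
  (integrable_finsetSum _ fun a _ => integrable_finsetSum _ fun b _ =>
    integrable_norm_vertex_sub_vertex_sq j a b).const_mul _

/-- With n = j+3, summing n|a-b| - (a-b)² over all pairs gives n(n³-n)/3 - n²(n²-1)/6 = n²(n²-1)/6;
the factor 12(2n-3)/(n(n+1)) and the average 1/(2n²) do the rest. -/
theorem integral_gyradiusSq (j : ℕ) :
    ∫ e : Arm (j + 3), gyradiusSq e ∂hopfGaussianClosed (j + 3) =
      (j + 2) / (j + 3) * (2 * j + 3) := by
  simp only [gyradiusSq]
  rw [integral_const_mul, integral_finsetSum _ fun a _ => integrable_finsetSum _ fun b _ =>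
    integrable_norm_vertex_sub_vertex_sq j a b]
  have h : ∀ a : Fin (j + 3), ∫ e : Arm (j + 3), ∑ b : Fin (j + 3),
      ‖vertex e a - vertex e b‖ ^ 2 ∂hopfGaussianClosed (j + 3) =
      ∑ b : Fin (j + 3), ((j + 3) * |((a : ℕ) : ℝ) - (b : ℕ)| - (((a : ℕ) : ℝ) - (b : ℕ)) ^ 2) *
        (12 * (2 * j + 3) / ((j + 3) * (j + 4))) := by
    intro a
    rw [integral_finsetSum _ fun b _ => integrable_norm_vertex_sub_vertex_sq j a b]
    exact Finset.sum_congr rfl fun b _ => integral_norm_vertex_sub_vertex_sq j a b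
  simp only [h]
  rw [Finset.sum_congr rfl fun (a : Fin (j + 3)) _ => Fin.sum_univ_eq_sum_range (fun b =>
      ((j + 3) * |((a : ℕ) : ℝ) - b| - (((a : ℕ) : ℝ) - b) ^ 2) *
        (12 * (2 * j + 3) / ((j + 3) * (j + 4)))) (j + 3),
    Fin.sum_univ_eq_sum_range (fun a => ∑ b ∈ Finset.range (j + 3),
      ((j + 3) * |(a : ℝ) - b| - ((a : ℝ) - b) ^ 2) *
        (12 * (2 * j + 3) / ((j + 3) * (j + 4)))) (j + 3)]
  simp only [← Finset.sum_mul, Finset.sum_sub_distrib, ← Finset.mul_sum]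
  rw [sum_range_sum_range_abs_sub, sum_range_sum_range_sub_sq]
  push_cast
  field_simp
  ring

theorem mainTheorem11 (n : ℕ) [NeZero n] (hn : 3 ≤ n) :
    IsProbabilityMeasure (hopfGaussianClosed n) ∧
    (∀ᵐ e ∂(hopfGaussianClosed n), e ∈ closedPolygons n) ∧
    (∀ (p : ℝ), -2 < p → ∀ i : Fin n,
      Integrable (fun e : Arm n => ‖e i‖ ^ p) (hopfGaussianClosed n) ∧
      ∫ e, ‖e i‖ ^ p ∂(hopfGaussianClosed n) =
        ((n : ℝ) - 1) * Real.Gamma (2 * (n : ℝ) + p - 3) / (2 * Real.Gamma (2 * (n : ℝ) - 4)) *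
          ProbabilityTheory.beta (p + 2) ((n : ℝ) - 2)) ∧
    (∀ (k : ℕ), k ≤ n → ∀ i : Fin n,
      Integrable (fun e : Arm n => chordSq k i e) (hopfGaussianClosed n) ∧
      ∫ e, chordSq k i e ∂(hopfGaussianClosed n) =
        (((n : ℝ) - (k : ℝ)) / (n : ℝ)) *
          (12 * (k : ℝ) * (2 * (n : ℝ) - 3) / ((n : ℝ) + 1))) ∧
    (Integrable (fun e : Arm n => gyradiusSq e) (hopfGaussianClosed n) ∧
      ∫ e, gyradiusSq e ∂(hopfGaussianClosed n) =
        (((n : ℝ) - 1) / (n : ℝ)) * (2 * (n : ℝ) - 3)) := by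
  -- The n-1 = j+2 free edges correspond to the profile of index j+1, whose integrand has the
  -- natural exponent j.
  obtain ⟨j, rfl⟩ : ∃ j, n = j + 3 := ⟨n - 3, by omega⟩
  refine ⟨inferInstance, ae_mem_closedPolygons _, fun p hp i => ⟨integrable_norm_edge_rpow j i hp,
    ?_⟩, fun k hk i => ⟨integrable_norm_vertex_add_sub_sq j i hk, ?_⟩, integrable_gyradiusSq j, ?_⟩
  · rw [integral_norm_edge_rpow j i hp]
    push_cast
    ring_nf
  · refine (integral_norm_vertex_add_sub_sq j i hk).trans ?_
    push_cast
    field_simp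
    ring
  · refine (integral_gyradiusSq j).trans ?_
    push_cast
    ring
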